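/- **Setting.** For $n\ge 1$ let $\mathcal S(\mathbb C^n)$ be the set of density operators on $\mathbb C^n$; states are composed by the tensor product. For density operators $\rho,\sigma$ write $\rho\prec_{\mathrm M}\sigma$ if for every $k$ the sum of the $k$ largest eigenvalues of $\rho$ is at least that of $\sigma$ (if the dimensions differ, the shorter spectrum is padded with zeros). For $\epsilon\ge 0$ let $\rho\prec^\epsilon\sigma$ (*smooth adiabatic operations*) mean that there are density operators $\rho',\sigma'$ on the spaces of $\rho,\sigma$ and reals $\epsilon',\epsilon''$ with $\epsilon'+\epsilon''\le\epsilon$, $\tfrac12\|\rho-\rho'\|_1\le\epsilon'$, $\tfrac12\|\sigma-\sigma'\|_1\le\epsilon''$ and $\rho'\prec_{\mathrm M}\sigma'$. Write $\prec$ for $\prec^0$, and $\rho\sim\sigma$ for $\rho\prec\sigma$ and $\sigma\prec\rho$. For integers $d\ge 1$ and $1\le m\le d$ let $\chi^{(d)}_\lambda$, $\lambda=\log_2 m$, be the diagonal state on $\mathbb C^d$ with eigenvalue $2^{-\lambda}=1/m$ of multiplicity $m$ and eigenvalue $0$ of multiplicity $d-m$. For $d\ge2$, the states $\chi^{(d)}_\lambda$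 with $\lambda\in\Lambda_d=\{\log_2 m: 1\le m\le d\}$ form the *step-spectrum meter* $\Gamma_{\Lambda_d}$ of size $d$. **1. Axioms.** Smooth adiabatic operations satisfy the following axioms for $X,Y,Z$ in $\Gamma=\mathcal S(\mathbb C^n)$, for every $n$; they also hold when $X,Y,Z$ are density operators on any, possibly different, spaces. - (A1) $X\prec^\epsilon X$ for all $\epsilon\ge0$. - (A2) If $\epsilon'\ge\epsilon\ge0$ and $X\prec^\epsilon Y$, then $X\prec^{\epsilon'}Y$. - (A3) If $\epsilon,\delta\ge 0$, $X\prec^\epsilon Y$ and $Y\prec^\delta Z$, then $X\prec^{\min\{\epsilon+\delta,1\}}Z$. - (A4) If $\epsilon\ge 0$ and $X\prec^\epsilon Y$, then $X\otimes W\prec^\epsilon Y\otimes W$ for every density operator $W$ on any $\mathbb C^{n'}$. **2. The meter.** For every $d\ge2$ and every $n\ge1$ the meter states $\chi_\lambda=\chi_\lambda^{(d)}$ satisfy (A1)–(A4) and the following meter axioms for $\Gamma=\mathcal S(\mathbb C^n)$. - (M1) For $X,Y\in\Gamma$, $\lambda\in\Lambda_d$ and $\epsilon\ge0$: $X\otimes\chi_\lambda\prec^\epsilon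 Y\otimes\chi_\lambda$ implies $X\prec^\epsilon Y$. - (M2) $\chi_\lambda\sim\chi_{\lambda_1}\otimes\chi_{\lambda_2}$ if and only if $\lambda=\lambda_1+\lambda_2$. This also holds when the three meter states have different sizes $d,d_1,d_2\ge1$. - (M3) There are two inequivalent meter states, and $\lambda_1\le\lambda_2$ if and only if $\chi_{\lambda_1}\prec\chi_{\lambda_2}$. - (M4) For $0\le\epsilon\le1$ and $\lambda_1>\lambda_2$: $\chi_{\lambda_1}\prec^\epsilon\chi_{\lambda_2}$ implies $\lambda_1\le\lambda_2-\log_2(1-\epsilon)$, where $-\log_2 0=\infty$. If moreover $d\ge n$, then the meter is *suitable* for measuring $\Gamma$: there is a reference state $\rho_{\rm ref}\in\Gamma$ such that for every $\rho\in\Gamma$ there are $\lambda_1,\dots,\lambda_4\in\Lambda_d$ with $\rho_{\rm ref}\otimes\chi_{\lambda_1}\prec\rho\otimes\chi_{\lambda_2}$ and $\rho\otimes\chi_{\lambda_3}\prec\rho_{\rm ref}\otimes\chi_{\lambda_4}$. The pure state $|0\rangle\langle0|$ of any vector $|0\rangle$ of the standard basis of $\mathbb C^n$ is such a reference state. **3.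 Entropies.** Let $\rho\in\mathcal S(\mathbb C^n)$, let $\rho_{\rm ref}=|0\rangle\langle 0|$, and define, over the extended reals and optimising over meters of all sizes, $$S_-^\epsilon(\rho)=\sup_{d\ge2}\ \sup\{\lambda_1-\lambda_2:\ \lambda_1,\lambda_2\in\Lambda_d,\ \rho_{\rm ref}\otimes\chi^{(d)}_{\lambda_1}\prec^\epsilon\rho\otimes\chi^{(d)}_{\lambda_2}\},$$ $$S_+^\epsilon(\rho)=\inf_{d\ge2}\ \inf\{\lambda_2-\lambda_1:\ \lambda_1,\lambda_2\in\Lambda_d,\ \rho\otimes\chi^{(d)}_{\lambda_1}\prec^\epsilon\rho_{\rm ref}\otimes\chi^{(d)}_{\lambda_2}\}.$$ - For $0\le\epsilon\le1$, $S_-^\epsilon(\rho)=H_{\min}^\epsilon(\rho):=\sup_{\tau}\bigl(-\log_2\lambda_{\max}(\tau)\bigr)$. The supremum is over all subnormalised states $\tau$ on $\mathbb C^n$ ($\tau\ge0$, $\operatorname{tr}\tau\le1$) with generalised trace distance $\tfrac12\|\rho-\tau\|_1+\tfrac12|\operatorname{tr}\rho-\operatorname{tr}\tau|\le\epsilon$,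 $\lambda_{\max}(\tau)$ is the largest eigenvalue of $\tau$, and $-\log_2 0=\infty$. - For $0\le\epsilon<1$, $S_+^\epsilon(\rho)=H_{\mathrm H}^{1-\epsilon}(\rho)+\log_2(1-\epsilon)$, where $$H_{\mathrm H}^{1-\epsilon}(\rho):=\log_2\inf\Bigl\{\tfrac{1}{1-\epsilon}\operatorname{tr}Q:\ \operatorname{tr}(Q\rho)\ge1-\epsilon,\ 0\le Q\le\mathbb 1\Bigr\}.$$ -/

import Mathlib

open scoped Kronecker ComplexOrder Matrix

noncomputable section

/-! ### Error-tolerant resource theories -/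

/-- The data of an error-tolerant resource theory: states, composition of states `(X, Y)`, and for
each error tolerance `ε` a relation `rel ε X Y`, meaning `X ≺^ε Y`. A state space is a set of
states. -/
structure ErrorTolerantTheory where
  State : Type
  comp : State → State → State
  rel : ℝ → State → State → Prop

namespace ErrorTolerantTheory

variable (R : ErrorTolerantTheory)

/-- `X ∼ Y`: error-free transformations in both directions. -/
def Equivalent (X Y : R.State) : Prop := R.rel 0 X Y ∧ R.rel 0 Y X

/-- Axioms (A1)–(A4) for the state space `Γ`. Errors are probabilities and are added as
`min (ε + δ) 1`. The state `Z` of (A4) is a state of an arbitrary further system. -/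
structure ObeysAxioms (Γ : Set R.State) : Prop where
  /-- (A1) reflexivity -/
  refl : ∀ X ∈ Γ, ∀ ε : ℝ, 0 ≤ ε → R.rel ε X X
  /-- (A2) ordering of error tolerances -/
  mono : ∀ X ∈ Γ, ∀ Y ∈ Γ, ∀ ε ε' : ℝ, 0 ≤ ε → ε ≤ ε' → R.rel ε X Y → R.rel ε' X Y
  /-- (A3) additive transitivity -/
  trans : ∀ X ∈ Γ, ∀ Y ∈ Γ, ∀ Z ∈ Γ, ∀ ε δ : ℝ, 0 ≤ ε → 0 ≤ δ →
    R.rel ε X Y → R.rel δ Y Z → R.rel (min (ε + δ) 1) X Z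
  /-- (A4) consistent composition -/
  comp : ∀ X ∈ Γ, ∀ Y ∈ Γ, ∀ Z : R.State, ∀ ε : ℝ, 0 ≤ ε →
    R.rel ε X Y → R.rel ε (R.comp X Z) (R.comp Y Z)

/-- A family of states `χ i` labelled by non-negative real parameters `label i`; the labels are
pairwise distinct, so this is a map `λ ↦ χ_λ` on the set of labels `Λ ⊆ ℝ_{≥0}`. -/
structure MeterSystem where
  Index : Type
  label : Index → ℝ
  label_nonneg : ∀ i, 0 ≤ label i
  label_injective : Function.Injective label
  state : Index → R.State

/-- The resource-error tradeoff function `f(ε) = -log₂ (1 - ε)`, with `f(1) = ∞`. -/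
def tradeoff (ε : ℝ) : EReal :=
  if ε < 1 then ((-Real.logb 2 (1 - ε) : ℝ) : EReal) else ⊤

/-- Axioms (M1)–(M4) for a meter system on a system with state space `Γ`. -/
structure ObeysMeterAxioms (Γ : Set R.State) (M : R.MeterSystem) : Prop where
  /-- (M1) reduction property -/
  reduction : ∀ X ∈ Γ, ∀ Y ∈ Γ, ∀ i : M.Index, ∀ ε : ℝ, 0 ≤ ε →
    R.rel ε (R.comp X (M.state i)) (R.comp Y (M.state i)) → R.rel ε X Y
  /-- (M2) additivity of meter states -/
  additive : ∀ i i₁ i₂ : M.Index,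
    R.Equivalent (M.state i) (R.comp (M.state i₁) (M.state i₂)) ↔
      M.label i = M.label i₁ + M.label i₂
  /-- (M3) ordering of meter states, first part -/
  nontrivial : ∃ i₁ i₂ : M.Index, ¬ R.Equivalent (M.state i₁) (M.state i₂)
  /-- (M3) ordering of meter states, second part -/
  ordering : ∀ i₁ i₂ : M.Index,
    M.label i₁ ≤ M.label i₂ ↔ R.rel 0 (M.state i₁) (M.state i₂)
  /-- (M4) resource-error tradeoff -/
  resource_error : ∀ i₁ i₂ : M.Index, ∀ ε : ℝ, 0 ≤ ε → ε ≤ 1 →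
    M.label i₂ < M.label i₁ → R.rel ε (M.state i₁) (M.state i₂) →
    ((M.label i₁ : ℝ) : EReal) ≤ ((M.label i₂ : ℝ) : EReal) + tradeoff ε

/-- `Xref ∈ Γ` is a reference state: every state of `Γ` can be produced from `Xref`, and turned
back into `Xref`, without error and with the help of the meter. -/
def IsReference (Γ : Set R.State) (M : R.MeterSystem) (Xref : R.State) : Prop :=
  Xref ∈ Γ ∧ ∀ X ∈ Γ, ∃ i₁ i₂ i₃ i₄ : M.Index,
    R.rel 0 (R.comp Xref (M.state i₁)) (R.comp X (M.state i₂)) ∧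
    R.rel 0 (R.comp X (M.state i₃)) (R.comp Xref (M.state i₄))

/-- Suitability of a meter system for measuring a system with state space `Γ`. -/
structure Suitable (Γ : Set R.State) (M : R.MeterSystem) : Prop where
  axioms : R.ObeysAxioms (Set.range M.state)
  meter : R.ObeysMeterAxioms Γ M
  reference : ∃ Xref : R.State, R.IsReference Γ M Xref

/-- `S_-^ε(X)` measured with the meter `M` and the reference state `Xref`. -/
def Sminus (M : R.MeterSystem) (Xref : R.State) (ε : ℝ) (X : R.State) : EReal :=
  sSup {s : EReal | ∃ i₁ i₂ : M.Index,
    R.rel ε (R.comp Xref (M.state i₁)) (R.comp X (M.state i₂)) ∧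
    s = ((M.label i₁ - M.label i₂ : ℝ) : EReal)}

/-- `S_+^ε(X)` measured with the meter `M` and the reference state `Xref`. -/
def Splus (M : R.MeterSystem) (Xref : R.State) (ε : ℝ) (X : R.State) : EReal :=
  sInf {s : EReal | ∃ i₁ i₂ : M.Index,
    R.rel ε (R.comp X (M.state i₁)) (R.comp Xref (M.state i₂)) ∧
    s = ((M.label i₂ - M.label i₁ : ℝ) : EReal)}

end ErrorTolerantTheory

/-! ### Quantum states on `ℂⁿ` -/

/-- Density operators on `ℂⁿ`. -/
structure DensityOp (n : ℕ) where
  mat : Matrix (Fin n) (Fin n) ℂ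
  posSemidef : mat.PosSemidef
  trace_eq_one : mat.trace = 1

/-- Subnormalised states on `ℂⁿ`: positive semidefinite operators of trace at most one. -/
structure SubDensityOp (n : ℕ) where
  mat : Matrix (Fin n) (Fin n) ℂ
  posSemidef : mat.PosSemidef
  trace_le_one : mat.trace.re ≤ 1

/-- The trace norm of a Hermitian matrix, `‖A‖₁ = ∑ |eigenvalues of A|`. -/
def traceNorm {n : ℕ} {A : Matrix (Fin n) (Fin n) ℂ} (hA : A.IsHermitian) : ℝ :=
  ∑ i, |hA.eigenvalues i|

/-- The trace distance `½ ‖ρ - σ‖₁`. -/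
def traceDist {n : ℕ} (ρ σ : DensityOp n) : ℝ :=
  1 / 2 * traceNorm (ρ.posSemidef.isHermitian.sub σ.posSemidef.isHermitian)

/-- The generalised trace distance `½ ‖ρ - τ‖₁ + ½ |tr ρ - tr τ|` to a subnormalised state. -/
def genTraceDist {n : ℕ} (ρ : DensityOp n) (τ : SubDensityOp n) : ℝ :=
  1 / 2 * traceNorm (ρ.posSemidef.isHermitian.sub τ.posSemidef.isHermitian)
    + 1 / 2 * |ρ.mat.trace.re - τ.mat.trace.re|

/-- The sum of the `k` largest eigenvalues (of all of them, if `k > n`).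
`Matrix.IsHermitian.eigenvalues₀` lists the eigenvalues in decreasing order. -/
def sumLargest {n : ℕ} (ρ : DensityOp n) (k : ℕ) : ℝ :=
  ∑ i with i.val < k, ρ.posSemidef.isHermitian.eigenvalues₀ i

/-- `ρ ≺_M σ`: `ρ` majorises `σ`. If the dimensions differ, the shorter spectrum is padded with
zeros. -/
def Majorises {n m : ℕ} (ρ : DensityOp n) (σ : DensityOp m) : Prop :=
  ∀ k : ℕ, sumLargest σ k ≤ sumLargest ρ k

/-- `ρ ≺_M^ε σ`: majorisation up to smoothing of input and output in trace distance. -/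
def SmoothMajorises {n m : ℕ} (ε : ℝ) (ρ : DensityOp n) (σ : DensityOp m) : Prop :=
  ∃ (ρ' : DensityOp n) (σ' : DensityOp m) (ε' ε'' : ℝ),
    Majorises ρ' σ' ∧ traceDist ρ ρ' ≤ ε' ∧ traceDist σ σ' ≤ ε'' ∧ ε' + ε'' ≤ ε

/-- The tensor product `ρ ⊗ σ`, on `ℂⁿ ⊗ ℂᵐ ≅ ℂⁿᵐ`. -/
def DensityOp.tensor {n m : ℕ} (ρ : DensityOp n) (σ : DensityOp m) : DensityOp (n * m) where
  mat := (ρ.mat ⊗ₖ σ.mat).submatrix finProdFinEquiv.symm finProdFinEquiv.symm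
  posSemidef := (ρ.posSemidef.kronecker σ.posSemidef).submatrix _
  trace_eq_one := by
    have h : ((ρ.mat ⊗ₖ σ.mat).submatrix finProdFinEquiv.symm finProdFinEquiv.symm).trace
        = (ρ.mat ⊗ₖ σ.mat).trace := by
      simp only [Matrix.trace, Matrix.diag_apply, Matrix.submatrix_apply]
      exact Equiv.sum_comp finProdFinEquiv.symm (fun p => (ρ.mat ⊗ₖ σ.mat) p p)
    rw [h, Matrix.trace_kronecker, ρ.trace_eq_one, σ.trace_eq_one, one_mul]

/-- The maximally mixed state on the first `j + 1` basis vectors of `ℂᵈ`; its spectrum is the step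
function with the value `1 / (j + 1)` on the first `j + 1` places and `0` after them. -/
def stepState {d : ℕ} (j : Fin d) : DensityOp d where
  mat := Matrix.diagonal fun i => if i ≤ j then (((j : ℕ) : ℂ) + 1)⁻¹ else 0
  posSemidef := by
    refine Matrix.PosSemidef.diagonal fun i => ?_
    dsimp only
    split_ifs
    · have h : (((j : ℕ) : ℂ) + 1)⁻¹ = (((((j : ℕ) : ℝ) + 1)⁻¹ : ℝ) : ℂ) := by push_cast; rfl
      rw [h]
      exact Complex.zero_le_real.mpr (by positivity)
    · exact le_rfl
  trace_eq_one := by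
    have h : (Finset.univ.filter fun i : Fin d => i ≤ j) = Finset.Iic j := by ext; simp
    rw [Matrix.trace_diagonal, ← Finset.sum_filter, Finset.sum_const, h, Fin.card_Iic,
      nsmul_eq_mul]
    push_cast
    exact mul_inv_cancel₀ (Nat.cast_add_one_ne_zero _)

/-- The pure state `|i⟩⟨i|` of a basis vector of `ℂⁿ`. -/
def basisState {n : ℕ} (i : Fin n) : DensityOp n where
  mat := Matrix.diagonal (Pi.single i 1)
  posSemidef := by
    refine Matrix.PosSemidef.diagonal fun k => ?_
    by_cases h : k = i
    · subst h; simp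
    · simp [h]
  trace_eq_one := by
    rw [Matrix.trace_diagonal, Finset.sum_pi_single']
    simp

/-! ### Smooth adiabatic operations -/

/-- A density operator on some `ℂⁿ`. -/
structure QState where
  dim : ℕ
  op : DensityOp dim

/-- The resource theory of smooth adiabatic operations. -/
def smoothAdiabatic : ErrorTolerantTheory where
  State := QState
  comp X Y := ⟨X.dim * Y.dim, X.op.tensor Y.op⟩
  rel ε X Y := SmoothMajorises ε X.op Y.op

/-- The state space `𝓢(ℂⁿ)`. -/
def stateSpace (n : ℕ) : Set smoothAdiabatic.State := Set.range (QState.mk n)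

/-- The step-spectrum meter of size `d`: labels `log₂ m` for `m = 1, …, d`, and for `λ = log₂ m`
the state with eigenvalue `2^(-λ) = 1 / m` of multiplicity `2^λ = m`. -/
def stepMeter (d : ℕ) : smoothAdiabatic.MeterSystem where
  Index := Fin d
  label j := Real.logb 2 ((j : ℕ) + 1)
  label_nonneg j := Real.logb_nonneg (by norm_num) (by simp)
  label_injective := by
    intro i j h
    have h' := Real.logb_injOn_pos (b := 2) (by norm_num)
      (Set.mem_Ioi.mpr (Nat.cast_add_one_pos (i : ℕ)))
      (Set.mem_Ioi.mpr (Nat.cast_add_one_pos (j : ℕ))) h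
    exact Fin.ext (by exact_mod_cast add_right_cancel h')
  state j := ⟨d, stepState j⟩

/-- `S_-^ε(ρ)` with reference state `ρref`, optimised over step meters of all sizes `d > 1`. -/
def entropyMinus {n : ℕ} (ρref : DensityOp n) (ε : ℝ) (ρ : DensityOp n) : EReal :=
  ⨆ (d : ℕ) (_ : 1 < d), smoothAdiabatic.Sminus (stepMeter d) ⟨n, ρref⟩ ε ⟨n, ρ⟩

/-- `S_+^ε(ρ)` with reference state `ρref`, optimised over step meters of all sizes `d > 1`. -/
def entropyPlus {n : ℕ} (ρref : DensityOp n) (ε : ℝ) (ρ : DensityOp n) : EReal :=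
  ⨅ (d : ℕ) (_ : 1 < d), smoothAdiabatic.Splus (stepMeter d) ⟨n, ρref⟩ ε ⟨n, ρ⟩

/-! ### Smooth entropies -/

/-- The largest eigenvalue (for `n ≥ 1`). -/
def maxEigenvalue {n : ℕ} (τ : SubDensityOp n) : ℝ :=
  ⨆ i, τ.posSemidef.isHermitian.eigenvalues i

/-- The min-entropy `-log₂ λ_max(τ)`, with the value `∞` for `τ = 0`. -/
def minEntropy {n : ℕ} (τ : SubDensityOp n) : EReal :=
  if maxEigenvalue τ = 0 then ⊤ else ((-Real.logb 2 (maxEigenvalue τ) : ℝ) : EReal)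

/-- The smooth min-entropy: supremum of the min-entropy over the subnormalised states that are
`ε`-close to `ρ` in generalised trace distance. -/
def smoothMinEntropy {n : ℕ} (ε : ℝ) (ρ : DensityOp n) : EReal :=
  ⨆ (τ : SubDensityOp n) (_ : genTraceDist ρ τ ≤ ε), minEntropy τ

/-- The hypothesis-testing entropy `H_H^α(ρ)` for `0 < α ≤ 1`, the logarithm of
`inf {α⁻¹ tr Q | tr (Q ρ) ≥ α, 0 ≤ Q ≤ 1}`. -/
def hypothesisTestingEntropy {n : ℕ} (α : ℝ) (ρ : DensityOp n) : ℝ :=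
  Real.logb 2 (sInf {x : ℝ | ∃ Q : Matrix (Fin n) (Fin n) ℂ,
    Q.PosSemidef ∧ (1 - Q).PosSemidef ∧ α ≤ (Q * ρ.mat).trace.re ∧ x = 1 / α * Q.trace.re})

end

/-!
The argument replaces sorted spectra by the excess function `t ↦ tr (ρ - t)₊ = ∑ (λᵢ - t)₊` of a
state, for thresholds `t ≥ 0`. It is the Legendre transform of the sums of the `k` largest
eigenvalues, it does not see a padding of the spectrum by zeros, and it is a plain sum over the
spectrum, so no ordering of eigenvalues is needed to compute it.

The central fact, `smoothMajorises_iff`, is that for `ε ≥ 0`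

  `ρ ≺^ε σ` if and only if `tr (σ - t)₊ ≤ tr (ρ - t)₊ + ε` for all `t ≥ 0`.

One direction is the variational principle `tr (ρ - t)₊ = max {tr Q (ρ - t) | 0 ≤ Q ≤ 1}`
(`re_trace_mul_le_excess_add`, `exists_re_trace_mul_eq_excess_add`), which shows that the excess
changes by at most the trace distance. For the other it suffices to smooth the input: moving the
weight `ε` from the smallest eigenvalues of `ρ` to its largest one raises all sums of largest
eigenvalues by `ε`, up to the bound `1` (`exists_smoothing`).

Reflexivity, monotonicity and transitivity are then immediate. The excess of `ρ ⊗ σ` is the mixture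
`∑ⱼ μⱼ tr (ρ - t / μⱼ)₊` over the eigenvalues `μⱼ` of `σ` (`excess_tensor`), which gives
compatibility with composition. A step state of rank `m` has excess `(1 - m t)₊`, and composition
with it replaces `t` by `m t` (`excess_tensor_stepState`); the meter axioms become elementary
statements about these functions.

For the entropies let `x = m₂ / m₁` be the ratio of the ranks of two meter states; such ratios are
dense in the positive reals. The transformation that defines `S_-` exists if and only if
`tr (ρ - x)₊ ≤ ε`, and `tr (ρ - x)₊` is also the smallest generalised trace distance from `ρ` to a
subnormalised state with largest eigenvalue at most `x`, attained by truncating the spectrum. The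
transformation that defines `S_+` exists if and only if `1 - ε ≤ tr (ρ - s)₊ + s x` for all
`s ≥ 0`. This is the dual form of the existence of a test `0 ≤ Q ≤ 1` with `tr Q ≤ x` and
`tr (Q ρ) ≥ 1 - ε`; an optimal test collects the largest eigenvalues of `ρ` (`exists_test`).
-/

noncomputable section

/-! ### Functions of a Hermitian matrix in its eigenbasis -/

section Spectral

variable {n : Type*} [Fintype n] [DecidableEq n] {A B : Matrix n n ℂ}

/-- If the characteristic polynomial of a Hermitian matrix splits with roots `p i`, then the `p i`
are its eigenvalues with multiplicity, so that symmetric sums over both families agree. -/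
theorem sum_eigenvalues_eq_of_charpoly_eq {ι : Type*} [Fintype ι] (hA : A.IsHermitian)
    (p : ι → ℝ) (h : A.charpoly = ∏ i, (Polynomial.X - Polynomial.C (p i : ℂ))) (f : ℝ → ℝ) :
    ∑ i, f (hA.eigenvalues i) = ∑ i, f (p i) := by
  have h1 := hA.roots_charpoly_eq_eigenvalues
  have h2 : A.charpoly.roots = Finset.univ.val.map fun i => (p i : ℂ) := by
    rw [h, Polynomial.roots_prod _ _ (Finset.prod_ne_zero_iff.mpr
      fun i _ => Polynomial.X_sub_C_ne_zero _)]
    simp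
  rw [h2] at h1
  have h3 := congrArg (fun s => (s.map fun z : ℂ => f z.re).sum) h1
  simp only [Multiset.map_map, Function.comp_def] at h3
  simpa using h3.symm

/-- The matrix with eigenvalues `f i` in the eigenbasis of the Hermitian matrix `A`. -/
def eigenbasisDiag (hA : A.IsHermitian) (f : n → ℝ) : Matrix n n ℂ :=
  (hA.eigenvectorUnitary : Matrix n n ℂ) * Matrix.diagonal (fun i => (f i : ℂ)) *
    (hA.eigenvectorUnitary : Matrix n n ℂ)ᴴ

theorem eigenvectorUnitary_conjTranspose_mul (hA : A.IsHermitian) :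
    (hA.eigenvectorUnitary : Matrix n n ℂ)ᴴ * (hA.eigenvectorUnitary : Matrix n n ℂ) = 1 :=
  Unitary.coe_star_mul_self hA.eigenvectorUnitary

theorem eigenvectorUnitary_mul_conjTranspose (hA : A.IsHermitian) :
    (hA.eigenvectorUnitary : Matrix n n ℂ) * (hA.eigenvectorUnitary : Matrix n n ℂ)ᴴ = 1 :=
  Unitary.coe_mul_star_self hA.eigenvectorUnitary

theorem eigenbasisDiag_eigenvalues (hA : A.IsHermitian) :
    eigenbasisDiag hA hA.eigenvalues = A := by
  conv_rhs => rw [hA.spectral_theorem, Unitary.conjStarAlgAut_apply]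
  rfl

theorem eigenbasisDiag_sub (hA : A.IsHermitian) (f g : n → ℝ) :
    eigenbasisDiag hA f - eigenbasisDiag hA g = eigenbasisDiag hA (f - g) := by
  simp only [eigenbasisDiag]
  rw [← Matrix.sub_mul, ← Matrix.mul_sub, Matrix.diagonal_sub]
  simp

theorem eigenbasisDiag_one (hA : A.IsHermitian) : eigenbasisDiag hA 1 = 1 := by
  simp [eigenbasisDiag, eigenvectorUnitary_mul_conjTranspose]

theorem eigenbasisDiag_zero (hA : A.IsHermitian) : eigenbasisDiag hA 0 = 0 := by
  simp [eigenbasisDiag]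

theorem charpoly_eigenbasisDiag (hA : A.IsHermitian) (f : n → ℝ) :
    (eigenbasisDiag hA f).charpoly = ∏ i, (Polynomial.X - Polynomial.C (f i : ℂ)) := by
  rw [eigenbasisDiag, Matrix.charpoly_mul_comm, ← Matrix.mul_assoc,
    eigenvectorUnitary_conjTranspose_mul, Matrix.one_mul, Matrix.charpoly_diagonal]

theorem posSemidef_eigenbasisDiag (hA : A.IsHermitian) {f : n → ℝ} (hf : ∀ i, 0 ≤ f i) :
    (eigenbasisDiag hA f).PosSemidef :=
  (Matrix.PosSemidef.diagonal fun i => Complex.zero_le_real.mpr (hf i)).mul_mul_conjTranspose_same _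

theorem posSemidef_one_sub_eigenbasisDiag (hA : A.IsHermitian) {f : n → ℝ} (hf : ∀ i, f i ≤ 1) :
    (1 - eigenbasisDiag hA f).PosSemidef := by
  rw [← eigenbasisDiag_one hA, eigenbasisDiag_sub]
  exact posSemidef_eigenbasisDiag hA fun i => by simpa using hf i

theorem trace_eigenbasisDiag (hA : A.IsHermitian) (f : n → ℝ) :
    (eigenbasisDiag hA f).trace = ((∑ i, f i : ℝ) : ℂ) := by
  rw [eigenbasisDiag, Matrix.trace_mul_comm, ← Matrix.mul_assoc,
    eigenvectorUnitary_conjTranspose_mul, Matrix.one_mul, Matrix.trace_diagonal]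
  simp

theorem trace_mul_eigenbasisDiag (hA : A.IsHermitian) (Q : Matrix n n ℂ) (f : n → ℝ) :
    (Q * eigenbasisDiag hA f).trace =
      ∑ i, ((hA.eigenvectorUnitary : Matrix n n ℂ)ᴴ * Q * hA.eigenvectorUnitary) i i * (f i : ℂ) := by
  rw [eigenbasisDiag, ← Matrix.mul_assoc, Matrix.trace_mul_comm, ← Matrix.mul_assoc,
    ← Matrix.mul_assoc]
  simp [Matrix.trace]

theorem trace_eigenbasisDiag_mul_eigenbasisDiag (hA : A.IsHermitian) (f g : n → ℝ) :
    (eigenbasisDiag hA f * eigenbasisDiag hA g).trace = ((∑ i, f i * g i : ℝ) : ℂ) := by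
  rw [trace_mul_eigenbasisDiag, eigenbasisDiag, ← Matrix.mul_assoc, ← Matrix.mul_assoc,
    eigenvectorUnitary_conjTranspose_mul, Matrix.one_mul, Matrix.mul_assoc,
    eigenvectorUnitary_conjTranspose_mul, Matrix.mul_one]
  simp

theorem sum_eigenvalues_eigenbasisDiag (hA : A.IsHermitian) {p : n → ℝ}
    (hB : B.IsHermitian) (h : B = eigenbasisDiag hA p) (f : ℝ → ℝ) :
    ∑ i, f (hB.eigenvalues i) = ∑ i, f (p i) := by
  subst h
  exact sum_eigenvalues_eq_of_charpoly_eq hB p (charpoly_eigenbasisDiag hA p) f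

theorem re_trace_eq_sum_eigenvalues (hA : A.IsHermitian) :
    A.trace.re = ∑ i, hA.eigenvalues i := by
  rw [hA.trace_eq_sum_eigenvalues]
  simp

/-! ### The excess function -/

/-- The excess `tr (A - t)₊ = ∑ (λᵢ - t)₊` of a Hermitian matrix `A` over the threshold `t`. -/
def excess (hA : A.IsHermitian) (t : ℝ) : ℝ := ∑ i, max (hA.eigenvalues i - t) 0

theorem excess_nonneg (hA : A.IsHermitian) (t : ℝ) : 0 ≤ excess hA t :=
  Finset.sum_nonneg fun _ _ => le_max_right _ _

theorem excess_eq_of_charpoly_eq {ι : Type*} [Fintype ι] (hA : A.IsHermitian) (p : ι → ℝ)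
    (h : A.charpoly = ∏ i, (Polynomial.X - Polynomial.C (p i : ℂ))) (t : ℝ) :
    excess hA t = ∑ i, max (p i - t) 0 :=
  sum_eigenvalues_eq_of_charpoly_eq hA p h fun x => max (x - t) 0

/-- One half of the variational principle `tr (A - t)₊ = max {tr Q (A - t) | 0 ≤ Q ≤ 1}`. -/
theorem re_trace_mul_le_excess_add (hA : A.IsHermitian) {Q : Matrix n n ℂ} (hQ : Q.PosSemidef)
    (hQ' : (1 - Q).PosSemidef) (t : ℝ) :
    (Q * A).trace.re ≤ excess hA t + t * Q.trace.re := by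
  set U : Matrix n n ℂ := (hA.eigenvectorUnitary : Matrix n n ℂ) with hU
  have hQA := trace_mul_eigenbasisDiag hA Q hA.eigenvalues
  rw [eigenbasisDiag_eigenvalues, ← hU] at hQA
  have hQ1 := trace_mul_eigenbasisDiag hA Q 1
  rw [eigenbasisDiag_one, Matrix.mul_one, ← hU] at hQ1
  have h0 : ∀ i, 0 ≤ ((Uᴴ * Q * U) i i).re := fun i =>
    (Complex.le_def.mp (hQ.conjTranspose_mul_mul_same U).diag_nonneg).1
  have h1 : ∀ i, ((Uᴴ * Q * U) i i).re ≤ 1 := fun i => by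
    have h := (Complex.le_def.mp ((hQ'.conjTranspose_mul_mul_same U).diag_nonneg (i := i))).1
    rw [Matrix.mul_sub, Matrix.sub_mul, Matrix.mul_one,
      eigenvectorUnitary_conjTranspose_mul] at h
    simpa using h
  rw [hQA, hQ1, excess]
  simp only [Complex.re_sum, Complex.re_mul_ofReal, Finset.mul_sum, ← Finset.sum_add_distrib]
  refine Finset.sum_le_sum fun i _ => ?_
  have ha := le_max_left (hA.eigenvalues i - t) 0
  have hb := le_max_right (hA.eigenvalues i - t) 0
  simp only [Pi.one_apply, mul_one]
  nlinarith [h0 i, h1 i, mul_le_mul_of_nonneg_left ha (h0 i), mul_nonneg hb (sub_nonneg.mpr (h1 i))]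

/-- The other half of the variational principle: the spectral projection of `A` to the eigenvalues
above `t` attains the excess. -/
theorem exists_re_trace_mul_eq_excess_add (hA : A.IsHermitian) (t : ℝ) :
    ∃ Q : Matrix n n ℂ, Q.PosSemidef ∧ (1 - Q).PosSemidef ∧
      (Q * A).trace.re = excess hA t + t * Q.trace.re := by
  refine ⟨eigenbasisDiag hA fun i => if t < hA.eigenvalues i then 1 else 0,
    posSemidef_eigenbasisDiag hA fun i => by split_ifs <;> norm_num,
    posSemidef_one_sub_eigenbasisDiag hA fun i => by split_ifs <;> norm_num, ?_⟩
  have h := trace_eigenbasisDiag_mul_eigenbasisDiag hA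
    (fun i => if t < hA.eigenvalues i then 1 else 0) hA.eigenvalues
  rw [eigenbasisDiag_eigenvalues] at h
  rw [h, trace_eigenbasisDiag, Complex.ofReal_re, Complex.ofReal_re, excess, Finset.mul_sum,
    ← Finset.sum_add_distrib]
  refine Finset.sum_congr rfl fun i _ => ?_
  split_ifs with hi
  · rw [max_eq_left (by linarith)]; ring
  · rw [max_eq_right (by linarith)]; ring

theorem excess_le_excess_add_excess_sub (hA : A.IsHermitian) (hB : B.IsHermitian) (t : ℝ) :
    excess hA t ≤ excess hB t + excess (hA.sub hB) 0 := by
  obtain ⟨Q, hQ, hQ', h⟩ := exists_re_trace_mul_eq_excess_add hA t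
  have h1 := re_trace_mul_le_excess_add hB hQ hQ' t
  have h2 := re_trace_mul_le_excess_add (hA.sub hB) hQ hQ' 0
  rw [Matrix.mul_sub, Matrix.trace_sub, Complex.sub_re] at h2
  linarith

/-- The excess over the threshold `0` is the trace of the positive part. -/
theorem excess_zero_eq (hA : A.IsHermitian) :
    excess hA 0 = 1 / 2 * ∑ i, |hA.eigenvalues i| + 1 / 2 * A.trace.re := by
  rw [re_trace_eq_sum_eigenvalues hA, Finset.mul_sum, Finset.mul_sum, ← Finset.sum_add_distrib,
    excess]
  refine Finset.sum_congr rfl fun i _ => ?_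
  rcases le_total 0 (hA.eigenvalues i) with h | h
  · rw [abs_of_nonneg h, max_eq_left (by linarith)]; ring
  · rw [abs_of_nonpos h, max_eq_right (by linarith)]; ring

/-- By convexity and `(λ - 0)₊ = λ`, the excess of a positive matrix lies below its chords that
start at the threshold `0`. -/
theorem excess_mul_le (hA : A.PosSemidef) {c : ℝ} (hc : 0 ≤ c) (hc' : c ≤ 1) (t : ℝ) :
    excess hA.isHermitian (c * t) ≤ (1 - c) * A.trace.re + c * excess hA.isHermitian t := by
  rw [re_trace_eq_sum_eigenvalues hA.isHermitian, excess, excess, Finset.mul_sum, Finset.mul_sum,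
    ← Finset.sum_add_distrib]
  refine Finset.sum_le_sum fun i _ => ?_
  have h0 := hA.eigenvalues_nonneg i
  have ha := le_max_left (hA.isHermitian.eigenvalues i - t) 0
  have hb := le_max_right (hA.isHermitian.eigenvalues i - t) 0
  refine max_le ?_ ?_
  · nlinarith [mul_le_mul_of_nonneg_left ha hc]
  · nlinarith [mul_nonneg hc hb, mul_nonneg (sub_nonneg.mpr hc') h0]

end Spectral

/-! ### Excess, trace distance and majorisation of states -/

/-- The excess function of a density operator. -/
abbrev DensityOp.excess {n : ℕ} (ρ : DensityOp n) (t : ℝ) : ℝ :=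
  _root_.excess ρ.posSemidef.isHermitian t

section States

variable {n m : ℕ}

theorem DensityOp.re_trace (ρ : DensityOp n) : ρ.mat.trace.re = 1 := by
  rw [ρ.trace_eq_one, Complex.one_re]

theorem DensityOp.sum_eigenvalues (ρ : DensityOp n) :
    ∑ i, ρ.posSemidef.isHermitian.eigenvalues i = 1 := by
  rw [← re_trace_eq_sum_eigenvalues, ρ.re_trace]

theorem DensityOp.excess_zero (ρ : DensityOp n) : ρ.excess 0 = 1 := by
  rw [DensityOp.excess, _root_.excess, ← ρ.sum_eigenvalues]
  exact Finset.sum_congr rfl fun i _ => by simp [ρ.posSemidef.eigenvalues_nonneg i]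

theorem DensityOp.excess_le_one (ρ : DensityOp n) {t : ℝ} (ht : 0 ≤ t) : ρ.excess t ≤ 1 := by
  rw [← ρ.excess_zero]
  exact Finset.sum_le_sum fun i _ => max_le_max (by linarith) le_rfl

/-- The excess of `ρ` is at most that of a pure state. -/
theorem DensityOp.excess_le (ρ : DensityOp n) {t : ℝ} (ht : 0 ≤ t) :
    ρ.excess t ≤ max (1 - t) 0 := by
  rcases le_total t 1 with h | h
  · have h1 := excess_mul_le ρ.posSemidef ht h 1
    have h2 : ρ.excess 1 = 0 := by
      refine Finset.sum_eq_zero fun i _ => max_eq_right ?_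
      have := Finset.single_le_sum (fun j _ => ρ.posSemidef.eigenvalues_nonneg j)
        (Finset.mem_univ i)
      rw [ρ.sum_eigenvalues] at this
      linarith
    rw [DensityOp.excess] at h2
    rw [h2, ρ.re_trace, mul_one] at h1
    exact le_max_of_le_left (by linarith)
  · refine le_max_of_le_right (Finset.sum_eq_zero fun i _ => max_eq_right ?_).le
    have := Finset.single_le_sum (fun j _ => ρ.posSemidef.eigenvalues_nonneg j)
      (Finset.mem_univ i)
    rw [ρ.sum_eigenvalues] at this
    linarith

theorem excess_sub_zero_eq_traceDist (ρ σ : DensityOp n) :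
    excess (ρ.posSemidef.isHermitian.sub σ.posSemidef.isHermitian) 0 = traceDist ρ σ := by
  rw [excess_zero_eq, Matrix.trace_sub, ρ.trace_eq_one, σ.trace_eq_one, traceDist, traceNorm]
  simp

theorem excess_sub_zero_eq_genTraceDist (ρ : DensityOp n) (τ : SubDensityOp n) :
    excess (ρ.posSemidef.isHermitian.sub τ.posSemidef.isHermitian) 0 = genTraceDist ρ τ := by
  rw [excess_zero_eq, Matrix.trace_sub, Complex.sub_re, genTraceDist, traceNorm,
    abs_of_nonneg (sub_nonneg.mpr (by rw [ρ.re_trace]; exact τ.trace_le_one))]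

theorem traceDist_comm (ρ σ : DensityOp n) : traceDist ρ σ = traceDist σ ρ := by
  have h : σ.mat - ρ.mat = eigenbasisDiag (ρ.posSemidef.isHermitian.sub σ.posSemidef.isHermitian)
      (0 - (ρ.posSemidef.isHermitian.sub σ.posSemidef.isHermitian).eigenvalues) := by
    rw [← eigenbasisDiag_sub, eigenbasisDiag_zero, eigenbasisDiag_eigenvalues]
    abel
  rw [traceDist, traceDist, traceNorm, traceNorm,
    sum_eigenvalues_eigenbasisDiag _ (σ.posSemidef.isHermitian.sub ρ.posSemidef.isHermitian) h
      fun x => |x|]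
  simp

theorem traceDist_self (ρ : DensityOp n) : traceDist ρ ρ = 0 := by
  have h : ρ.mat - ρ.mat = eigenbasisDiag ρ.posSemidef.isHermitian 0 := by
    rw [eigenbasisDiag_zero, sub_self]
  rw [traceDist, traceNorm, sum_eigenvalues_eigenbasisDiag _ _ h fun x => |x|]
  simp

theorem DensityOp.excess_le_add_traceDist (ρ σ : DensityOp n) (t : ℝ) :
    ρ.excess t ≤ σ.excess t + traceDist ρ σ := by
  rw [← excess_sub_zero_eq_traceDist]
  exact excess_le_excess_add_excess_sub _ _ t

end States

/-! ### Sorted spectra -/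

section Sorted

variable {n m : ℕ}

/-- The eigenvalues of `ρ` in decreasing order, continued by zeros. -/
def DensityOp.sortedEigenvalue (ρ : DensityOp n) (k : ℕ) : ℝ :=
  if h : k < Fintype.card (Fin n) then ρ.posSemidef.isHermitian.eigenvalues₀ ⟨k, h⟩ else 0

/-- The place in the decreasing order of the eigenvalue that Mathlib's `eigenvalues` lists under
the label `i`. -/
def eigenvaluePlace (i : Fin n) : ℕ :=
  ((Fintype.equivOfCardEq (Fintype.card_fin _) :
    Fin (Fintype.card (Fin n)) ≃ Fin n).symm i : ℕ)

theorem sum_eigenvaluePlace (f : ℕ → ℝ) :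
    ∑ i : Fin n, f (eigenvaluePlace i) = ∑ k ∈ Finset.range n, f k := by
  have h := Equiv.sum_comp (Fintype.equivOfCardEq (Fintype.card_fin _) :
    Fin (Fintype.card (Fin n)) ≃ Fin n).symm fun i => f i
  exact (h.trans (Fin.sum_univ_eq_sum_range f _)).trans (by rw [Fintype.card_fin])

theorem DensityOp.eigenvalues_eq_sortedEigenvalue (ρ : DensityOp n) (i : Fin n) :
    ρ.posSemidef.isHermitian.eigenvalues i = ρ.sortedEigenvalue (eigenvaluePlace i) := by
  have h : eigenvaluePlace i < Fintype.card (Fin n) := Fin.is_lt _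
  rw [DensityOp.sortedEigenvalue, dif_pos h]
  rfl

theorem DensityOp.sortedEigenvalue_of_le (ρ : DensityOp n) {k : ℕ} (h : n ≤ k) :
    ρ.sortedEigenvalue k = 0 := by
  rw [DensityOp.sortedEigenvalue, dif_neg (by simpa using h)]

theorem DensityOp.sortedEigenvalue_nonneg (ρ : DensityOp n) (k : ℕ) :
    0 ≤ ρ.sortedEigenvalue k := by
  rw [DensityOp.sortedEigenvalue]
  split_ifs with h
  · have := ρ.posSemidef.eigenvalues_nonneg
      ((Fintype.equivOfCardEq (Fintype.card_fin _) :
        Fin (Fintype.card (Fin n)) ≃ Fin n) ⟨k, h⟩)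
    rwa [Matrix.IsHermitian.eigenvalues, Equiv.symm_apply_apply] at this
  · exact le_rfl

theorem DensityOp.sortedEigenvalue_antitone (ρ : DensityOp n) : Antitone ρ.sortedEigenvalue := by
  intro j k hjk
  by_cases h : k < Fintype.card (Fin n)
  · rw [DensityOp.sortedEigenvalue, DensityOp.sortedEigenvalue, dif_pos h,
      dif_pos (hjk.trans_lt h)]
    exact ρ.posSemidef.isHermitian.eigenvalues₀_antitone hjk
  · rw [ρ.sortedEigenvalue_of_le (by simpa using h)]
    exact ρ.sortedEigenvalue_nonneg j

theorem sumLargest_eq_sum_range (ρ : DensityOp n) (k : ℕ) :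
    sumLargest ρ k = ∑ i ∈ Finset.range k, ρ.sortedEigenvalue i := by
  have h1 : sumLargest ρ k = ∑ i : Fin (Fintype.card (Fin n)),
      if i.val < k then ρ.sortedEigenvalue i else 0 := by
    rw [sumLargest, Finset.sum_filter]
    refine Finset.sum_congr rfl fun i _ => ?_
    rw [DensityOp.sortedEigenvalue, dif_pos i.is_lt]
  rw [h1, Fin.sum_univ_eq_sum_range (fun i => if i < k then ρ.sortedEigenvalue i else 0),
    ← Finset.sum_filter, Fintype.card_fin]
  refine Finset.sum_subset (fun i hi => by simp_all) fun i hi hi' => ?_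
  refine ρ.sortedEigenvalue_of_le ?_
  simp_all

theorem DensityOp.excess_eq_sum_range (ρ : DensityOp n) {t : ℝ} (ht : 0 ≤ t) {N : ℕ}
    (hN : n ≤ N) : ρ.excess t = ∑ k ∈ Finset.range N, max (ρ.sortedEigenvalue k - t) 0 := by
  rw [DensityOp.excess, _root_.excess]
  simp only [ρ.eigenvalues_eq_sortedEigenvalue]
  rw [sum_eigenvaluePlace fun k => max (ρ.sortedEigenvalue k - t) 0]
  refine Finset.sum_subset (Finset.range_subset_range.mpr hN) fun k _ hk => ?_
  rw [ρ.sortedEigenvalue_of_le (by simpa using hk)]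
  exact max_eq_right (by linarith)

theorem sumLargest_of_le (ρ : DensityOp n) {k : ℕ} (h : n ≤ k) : sumLargest ρ k = 1 := by
  rw [sumLargest_eq_sum_range, ← ρ.excess_zero, ρ.excess_eq_sum_range le_rfl h]
  exact Finset.sum_congr rfl fun i _ => by simp [ρ.sortedEigenvalue_nonneg i]

theorem sumLargest_zero (ρ : DensityOp n) : sumLargest ρ 0 = 0 := by
  simp [sumLargest_eq_sum_range]

theorem sumLargest_succ (ρ : DensityOp n) (k : ℕ) :
    sumLargest ρ (k + 1) = sumLargest ρ k + ρ.sortedEigenvalue k := by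
  simp [sumLargest_eq_sum_range, Finset.sum_range_succ]

theorem sumLargest_mono (ρ : DensityOp n) : Monotone (sumLargest ρ) :=
  monotone_nat_of_le_succ fun k => by
    rw [sumLargest_succ]; linarith [ρ.sortedEigenvalue_nonneg k]

theorem sumLargest_le_one (ρ : DensityOp n) (k : ℕ) : sumLargest ρ k ≤ 1 := by
  rw [← sumLargest_of_le ρ (le_max_left n k)]
  exact sumLargest_mono ρ (le_max_right n k)

theorem sumLargest_le_excess_add (ρ : DensityOp n) {t : ℝ} (ht : 0 ≤ t) (k : ℕ) :
    sumLargest ρ k ≤ ρ.excess t + k * t := by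
  have h : ∑ i ∈ Finset.range k, max (ρ.sortedEigenvalue i - t) 0 ≤ ρ.excess t := by
    rw [ρ.excess_eq_sum_range ht (le_max_left n k)]
    exact Finset.sum_le_sum_of_subset_of_nonneg
      (Finset.range_subset_range.mpr (le_max_right n k)) fun _ _ _ => le_max_right _ _
  have h2 : sumLargest ρ k ≤ ∑ i ∈ Finset.range k, (max (ρ.sortedEigenvalue i - t) 0 + t) := by
    rw [sumLargest_eq_sum_range]
    exact Finset.sum_le_sum fun i _ => by linarith [le_max_left (ρ.sortedEigenvalue i - t) 0]
  rw [Finset.sum_add_distrib, Finset.sum_const, Finset.card_range, nsmul_eq_mul] at h2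
  linarith

/-- A threshold that separates the `k` largest eigenvalues from the others turns
`sumLargest_le_excess_add` into an equality. -/
theorem excess_add_eq_sumLargest (ρ : DensityOp n) {t : ℝ} (ht : 0 ≤ t) {k : ℕ}
    (h1 : ∀ i < k, t ≤ ρ.sortedEigenvalue i) (h2 : ∀ i, k ≤ i → ρ.sortedEigenvalue i ≤ t) :
    ρ.excess t + k * t = sumLargest ρ k := by
  have h : ρ.excess t = ∑ i ∈ Finset.range k, (ρ.sortedEigenvalue i - t) := by
    rw [ρ.excess_eq_sum_range ht (le_max_left n k)]
    rw [← Finset.sum_subset (Finset.range_subset_range.mpr (le_max_right n k))]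
    · exact Finset.sum_congr rfl fun i hi => max_eq_left
        (sub_nonneg.mpr (h1 i (Finset.mem_range.mp hi)))
    · exact fun i _ hi => max_eq_right (sub_nonpos.mpr (h2 i (by simpa using hi)))
  rw [h, sumLargest_eq_sum_range, Finset.sum_sub_distrib, Finset.sum_const, Finset.card_range,
    nsmul_eq_mul]
  ring

theorem excess_sortedEigenvalue_add (ρ : DensityOp n) (k : ℕ) :
    ρ.excess (ρ.sortedEigenvalue k) + k * ρ.sortedEigenvalue k = sumLargest ρ k :=
  excess_add_eq_sumLargest ρ (ρ.sortedEigenvalue_nonneg k)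
    (fun _ hi => ρ.sortedEigenvalue_antitone hi.le) fun _ hi => ρ.sortedEigenvalue_antitone hi

theorem exists_excess_add_eq_sumLargest (ρ : DensityOp n) {t : ℝ} (ht : 0 ≤ t) :
    ∃ k : ℕ, ρ.excess t + k * t = sumLargest ρ k := by
  have hex : ∃ k, ρ.sortedEigenvalue k ≤ t := ⟨n, by rwa [ρ.sortedEigenvalue_of_le le_rfl]⟩
  classical
  exact ⟨Nat.find hex, excess_add_eq_sumLargest ρ ht
    (fun i hi => (not_le.mp (Nat.find_min hex hi)).le)
    fun i hi => (ρ.sortedEigenvalue_antitone hi).trans (Nat.find_spec hex)⟩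

/-- The sums of largest eigenvalues and the excess are Legendre transforms of each other, so an
inequality up to a constant between the former is the same as one between the latter. -/
theorem forall_sumLargest_le_iff (ρ : DensityOp n) (σ : DensityOp m) (ε : ℝ) :
    (∀ k, sumLargest σ k ≤ sumLargest ρ k + ε) ↔
      ∀ t, 0 ≤ t → σ.excess t ≤ ρ.excess t + ε := by
  constructor
  · intro h t ht
    obtain ⟨k, hk⟩ := exists_excess_add_eq_sumLargest σ ht
    linarith [h k, sumLargest_le_excess_add ρ ht k]
  · intro h k
    have ht := ρ.sortedEigenvalue_nonneg k
    linarith [h _ ht, sumLargest_le_excess_add σ ht k, excess_sortedEigenvalue_add ρ k]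

/-- The state with the eigenvalues `p 0, …, p (n - 1)` in the eigenbasis of `ρ`, where `p k` takes
the place of the `k`-th largest eigenvalue of `ρ`. -/
def DensityOp.withSpectrum (ρ : DensityOp n) (p : ℕ → ℝ) (hp : ∀ k, 0 ≤ p k)
    (hp' : ∑ k ∈ Finset.range n, p k = 1) : DensityOp n where
  mat := eigenbasisDiag ρ.posSemidef.isHermitian fun i => p (eigenvaluePlace i)
  posSemidef := posSemidef_eigenbasisDiag _ fun _ => hp _
  trace_eq_one := by
    rw [trace_eigenbasisDiag, sum_eigenvaluePlace, hp', Complex.ofReal_one]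

/-- Moving the weight `ε` from the smallest eigenvalues of `ρ` to the largest one is the optimal
smoothing: it raises all sums of largest eigenvalues by `ε`, as far as normalisation permits. -/
theorem exists_smoothing (ρ : DensityOp n) {ε : ℝ} (hε : 0 ≤ ε) :
    ∃ ρ' : DensityOp n, traceDist ρ ρ' ≤ ε ∧
      ∀ k, k ≠ 0 → min (sumLargest ρ k + ε) 1 ≤ sumLargest ρ' k := by
  -- `c k` is the sum of the `k` largest eigenvalues after smoothing
  set c : ℕ → ℝ := fun k => if k = 0 then 0 else min (sumLargest ρ k + ε) 1 with hc
  have hsum : ∀ k, 0 ≤ sumLargest ρ k := fun k => by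
    rw [← sumLargest_zero ρ]; exact sumLargest_mono ρ (Nat.zero_le k)
  have hcn : ∀ k, n ≤ k → c k = 1 := by
    intro k hk
    have hk0 : k ≠ 0 := by
      rintro rfl
      have := sumLargest_of_le ρ hk
      rw [sumLargest_zero] at this
      exact zero_ne_one this
    simp only [hc, if_neg hk0, sumLargest_of_le ρ hk]
    exact min_eq_right (by linarith)
  have hmono : ∀ k, c k ≤ c (k + 1) := by
    intro k
    simp only [hc, Nat.succ_ne_zero, if_false]
    split_ifs
    · exact le_min (by linarith [hsum (k + 1)]) zero_le_one
    · exact min_le_min_right _ (by linarith [sumLargest_mono ρ (Nat.le_succ k)])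
  have hp : ∀ k, 0 ≤ c (k + 1) - c k := fun k => sub_nonneg.mpr (hmono k)
  have hsump : ∀ k, ∑ i ∈ Finset.range k, (c (i + 1) - c i) = c k := fun k => by
    rw [Finset.sum_range_sub]; simp [hc]
  refine ⟨ρ.withSpectrum _ hp (by rw [hsump, hcn n le_rfl]), ?_, ?_⟩
  · rw [traceDist_comm, ← excess_sub_zero_eq_traceDist]
    have hmat : (ρ.withSpectrum _ hp (by rw [hsump, hcn n le_rfl])).mat - ρ.mat =
        eigenbasisDiag ρ.posSemidef.isHermitian
          ((fun i => c (eigenvaluePlace i + 1) - c (eigenvaluePlace i)) -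
            ρ.posSemidef.isHermitian.eigenvalues) := by
      rw [← eigenbasisDiag_sub, eigenbasisDiag_eigenvalues]
      rfl
    rw [excess, sum_eigenvalues_eigenbasisDiag _ _ hmat fun x => max (x - 0) 0]
    simp only [Pi.sub_apply, ρ.eigenvalues_eq_sortedEigenvalue]
    rw [sum_eigenvaluePlace fun k => max (c (k + 1) - c k - ρ.sortedEigenvalue k - 0) 0]
    -- only the largest eigenvalue grows, and by at most `ε`
    have hle : ∀ k, max (c (k + 1) - c k - ρ.sortedEigenvalue k - 0) 0 ≤ if k = 0 then ε else 0 := by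
      intro k
      refine max_le ?_ (by split_ifs <;> simp [hε])
      simp only [hc, Nat.succ_ne_zero, if_false, sumLargest_succ]
      split_ifs with hk
      · subst hk
        linarith [min_le_left (sumLargest ρ 0 + ρ.sortedEigenvalue 0 + ε) 1, sumLargest_zero ρ]
      · have := ρ.sortedEigenvalue_nonneg k
        rcases min_choice (sumLargest ρ k + ε) 1 with h | h
        · linarith [min_le_left (sumLargest ρ k + ρ.sortedEigenvalue k + ε) 1]
        · linarith [min_le_right (sumLargest ρ k + ρ.sortedEigenvalue k + ε) 1]
    refine (Finset.sum_le_sum fun k _ => hle k).trans ?_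
    rw [Finset.sum_ite_eq']
    split_ifs <;> simp [hε]
  · intro k hk
    set ρ' := ρ.withSpectrum _ hp (by rw [hsump, hcn n le_rfl]) with hρ'
    have hck : min (sumLargest ρ k + ε) 1 = c k := by simp [hc, hk]
    rw [hck]
    rcases le_total n k with h | h
    · rw [hcn k h, sumLargest_of_le ρ' h]
    · set t := ρ'.sortedEigenvalue k with ht
      have hex : ρ'.excess t = ∑ i ∈ Finset.range n, max (c (i + 1) - c i - t) 0 := by
        have hs := sum_eigenvalues_eigenbasisDiag ρ.posSemidef.isHermitian
          ρ'.posSemidef.isHermitian rfl fun x => max (x - t) 0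
        rw [DensityOp.excess, _root_.excess, hs,
          sum_eigenvaluePlace fun i => max (c (i + 1) - c i - t) 0]
      have h1 : ∑ i ∈ Finset.range k, max (c (i + 1) - c i - t) 0 ≤ ρ'.excess t := by
        rw [hex]
        exact Finset.sum_le_sum_of_subset_of_nonneg (Finset.range_subset_range.mpr h)
          fun _ _ _ => le_max_right _ _
      have h2 : c k ≤ ∑ i ∈ Finset.range k, (max (c (i + 1) - c i - t) 0 + t) := by
        rw [← hsump k]
        exact Finset.sum_le_sum fun i _ => by linarith [le_max_left (c (i + 1) - c i - t) 0]
      rw [Finset.sum_add_distrib, Finset.sum_const, Finset.card_range, nsmul_eq_mul] at h2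
      rw [← excess_sortedEigenvalue_add ρ' k, ← ht]
      linarith

/-- Smooth majorisation is an inequality, up to the error `ε`, between excess functions. -/
theorem smoothMajorises_iff (ρ : DensityOp n) (σ : DensityOp m) {ε : ℝ} (hε : 0 ≤ ε) :
    SmoothMajorises ε ρ σ ↔ ∀ t, 0 ≤ t → σ.excess t ≤ ρ.excess t + ε := by
  constructor
  · rintro ⟨ρ', σ', ε', ε'', hM, h1, h2, h3⟩ t ht
    have hM' := (forall_sumLargest_le_iff ρ' σ' 0).mp (fun k => by simpa using hM k) t ht
    have h4 := σ.excess_le_add_traceDist σ' t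
    have h5 := ρ'.excess_le_add_traceDist ρ t
    rw [traceDist_comm] at h5
    linarith
  · intro h
    rw [← forall_sumLargest_le_iff] at h
    obtain ⟨ρ', h1, h2⟩ := exists_smoothing ρ hε
    refine ⟨ρ', σ, ε, 0, fun k => ?_, h1, (traceDist_self σ).le, by simp⟩
    rcases eq_or_ne k 0 with rfl | hk
    · rw [sumLargest_zero, sumLargest_zero]
    · exact (le_min (h k) (sumLargest_le_one σ k)).trans (h2 k hk)

end Sorted

/-! ### Excess of tensor products and of meter states -/

section Tensor

variable {n m d : ℕ}

theorem charpoly_tensor (ρ : DensityOp n) (σ : DensityOp m) :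
    (ρ.tensor σ).mat.charpoly = ∏ p : Fin n × Fin m, (Polynomial.X - Polynomial.C
      ((ρ.posSemidef.isHermitian.eigenvalues p.1 * σ.posSemidef.isHermitian.eigenvalues p.2 : ℝ) :
        ℂ)) := by
  have h1 : (ρ.tensor σ).mat.charpoly = (ρ.mat ⊗ₖ σ.mat).charpoly :=
    Matrix.charpoly_reindex finProdFinEquiv (ρ.mat ⊗ₖ σ.mat)
  rw [h1]
  conv_lhs => rw [← eigenbasisDiag_eigenvalues ρ.posSemidef.isHermitian,
    ← eigenbasisDiag_eigenvalues σ.posSemidef.isHermitian]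
  rw [eigenbasisDiag, eigenbasisDiag, Matrix.mul_kronecker_mul, Matrix.mul_kronecker_mul,
    Matrix.charpoly_mul_comm, ← Matrix.mul_assoc, ← Matrix.mul_kronecker_mul,
    eigenvectorUnitary_conjTranspose_mul, eigenvectorUnitary_conjTranspose_mul,
    Matrix.one_kronecker_one, Matrix.one_mul, Matrix.diagonal_kronecker_diagonal,
    Matrix.charpoly_diagonal]
  simp

/-- The excess of a tensor product is a mixture of rescaled excesses. If the `j`-th eigenvalue
of `σ` vanishes, so does its term, whatever the value of `t / 0`. -/
theorem excess_tensor (ρ : DensityOp n) (σ : DensityOp m) {t : ℝ} (ht : 0 ≤ t) :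
    (ρ.tensor σ).excess t = ∑ j, σ.posSemidef.isHermitian.eigenvalues j *
      ρ.excess (t / σ.posSemidef.isHermitian.eigenvalues j) := by
  rw [DensityOp.excess, excess_eq_of_charpoly_eq _ _ (charpoly_tensor ρ σ), Fintype.sum_prod_type,
    Finset.sum_comm]
  refine Finset.sum_congr rfl fun j _ => ?_
  rw [DensityOp.excess, _root_.excess, Finset.mul_sum]
  refine Finset.sum_congr rfl fun i _ => ?_
  rcases (σ.posSemidef.eigenvalues_nonneg j).eq_or_lt' with h | h
  · simp [h, ht]
  · rw [mul_max_of_nonneg _ _ h.le, mul_sub, mul_div_cancel₀ _ h.ne', mul_zero, mul_comm]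

theorem sum_eigenvalues_stepState (j : Fin d) (f : ℝ → ℝ) :
    ∑ i, f ((stepState j).posSemidef.isHermitian.eigenvalues i) =
      ∑ i : Fin d, f (if i ≤ j then (((j : ℕ) : ℝ) + 1)⁻¹ else 0) := by
  refine sum_eigenvalues_eq_of_charpoly_eq _ _ ?_ f
  rw [stepState, Matrix.charpoly_diagonal]
  refine Finset.prod_congr rfl fun i _ => ?_
  split_ifs <;> simp

theorem sum_ite_le_const (j : Fin d) (x : ℝ) :
    ∑ i : Fin d, (if i ≤ j then x else 0) = (((j : ℕ) : ℝ) + 1) * x := by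
  have h : (Finset.univ.filter fun i : Fin d => i ≤ j) = Finset.Iic j := by ext; simp
  rw [← Finset.sum_filter, Finset.sum_const, h, Fin.card_Iic, nsmul_eq_mul]
  push_cast
  rfl

/-- Composition with a step state of rank `j + 1` stretches the excess function. -/
theorem excess_tensor_stepState (ρ : DensityOp n) (j : Fin d) {t : ℝ} (ht : 0 ≤ t) :
    (ρ.tensor (stepState j)).excess t = ρ.excess ((((j : ℕ) : ℝ) + 1) * t) := by
  have hj : (0 : ℝ) < ((j : ℕ) : ℝ) + 1 := by positivity
  rw [excess_tensor _ _ ht, sum_eigenvalues_stepState j fun x => x * ρ.excess (t / x)]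
  have h : ∀ i : Fin d, (if i ≤ j then (((j : ℕ) : ℝ) + 1)⁻¹ else 0) *
      ρ.excess (t / if i ≤ j then (((j : ℕ) : ℝ) + 1)⁻¹ else 0) =
      if i ≤ j then (((j : ℕ) : ℝ) + 1)⁻¹ * ρ.excess ((((j : ℕ) : ℝ) + 1) * t) else 0 := by
    intro i
    split_ifs
    · rw [div_inv_eq_mul, mul_comm t]
    · rw [zero_mul]
  simp only [h]
  rw [sum_ite_le_const, mul_inv_cancel_left₀ hj.ne']

theorem excess_stepState (j : Fin d) {t : ℝ} (ht : 0 ≤ t) :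
    (stepState j).excess t = max (1 - (((j : ℕ) : ℝ) + 1) * t) 0 := by
  have hj : (0 : ℝ) < ((j : ℕ) : ℝ) + 1 := by positivity
  rw [DensityOp.excess, excess, sum_eigenvalues_stepState j fun x => max (x - t) 0]
  have h : ∀ i : Fin d, max ((if i ≤ j then (((j : ℕ) : ℝ) + 1)⁻¹ else 0) - t) 0 =
      if i ≤ j then max ((((j : ℕ) : ℝ) + 1)⁻¹ - t) 0 else 0 := by
    intro i
    split_ifs
    · rfl
    · exact max_eq_right (by linarith)
  simp only [h]
  rw [sum_ite_le_const, mul_max_of_nonneg _ _ hj.le, mul_sub, mul_inv_cancel₀ hj.ne', mul_zero]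

theorem excess_basisState (i : Fin n) {t : ℝ} (ht : 0 ≤ t) :
    (basisState i).excess t = max (1 - t) 0 := by
  rw [DensityOp.excess, excess_eq_of_charpoly_eq _ (Pi.single i (1 : ℝ))]
  · rw [Finset.sum_eq_single i]
    · simp
    · intro k _ hk
      simp [hk, ht]
    · simp
  · rw [basisState, Matrix.charpoly_diagonal]
    refine Finset.prod_congr rfl fun k _ => ?_
    rcases eq_or_ne k i with rfl | h <;> simp [*]

/-- The excess functions `(1 - m t)₊` of step states of rank `m` decrease strictly with the rank:
the thresholds `t = 1 / a` distinguish the ranks. -/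
theorem max_one_sub_mul_le_iff {a b : ℝ} (ha : 0 < a) :
    (∀ t, 0 ≤ t → max (1 - b * t) 0 ≤ max (1 - a * t) 0) ↔ a ≤ b := by
  constructor
  · intro h
    have h1 := (le_max_left _ _).trans (h a⁻¹ (inv_nonneg.mpr ha.le))
    rw [mul_inv_cancel₀ ha.ne', sub_self, max_self, ← div_eq_mul_inv, sub_nonpos, one_le_div ha] at h1
    exact h1
  · intro h t ht
    exact max_le_max_right _ (by nlinarith)

end Tensor

/-! ### The axioms -/

theorem smoothAdiabatic_rel_iff (X Y : smoothAdiabatic.State) {ε : ℝ} (hε : 0 ≤ ε) :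
    smoothAdiabatic.rel ε X Y ↔ ∀ t, 0 ≤ t → Y.op.excess t ≤ X.op.excess t + ε :=
  smoothMajorises_iff X.op Y.op hε

theorem smoothAdiabatic_rel_zero_iff (X Y : smoothAdiabatic.State) :
    smoothAdiabatic.rel 0 X Y ↔ ∀ t, 0 ≤ t → Y.op.excess t ≤ X.op.excess t := by
  simpa using smoothAdiabatic_rel_iff X Y le_rfl

theorem smoothAdiabatic_obeysAxioms (Γ : Set smoothAdiabatic.State) :
    smoothAdiabatic.ObeysAxioms Γ where
  refl X _ ε hε := by
    rw [smoothAdiabatic_rel_iff X X hε]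
    intro t _
    linarith
  mono X _ Y _ ε ε' hε hεε' h := by
    rw [smoothAdiabatic_rel_iff X Y hε] at h
    rw [smoothAdiabatic_rel_iff X Y (hε.trans hεε')]
    intro t ht
    linarith [h t ht]
  trans X _ Y _ Z _ ε δ hε hδ h1 h2 := by
    rw [smoothAdiabatic_rel_iff X Y hε] at h1
    rw [smoothAdiabatic_rel_iff Y Z hδ] at h2
    rw [smoothAdiabatic_rel_iff X Z (le_min (add_nonneg hε hδ) zero_le_one)]
    intro t ht
    rw [← min_add_add_left]
    have h3 := excess_nonneg X.op.posSemidef.isHermitian t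
    exact le_min (by linarith [h1 t ht, h2 t ht]) (by linarith [Z.op.excess_le_one ht])
  comp X _ Y _ W ε hε h := by
    rw [smoothAdiabatic_rel_iff X Y hε] at h
    rw [smoothAdiabatic_rel_iff _ _ hε]
    intro t ht
    change (Y.op.tensor W.op).excess t ≤ (X.op.tensor W.op).excess t + ε
    rw [excess_tensor _ _ ht, excess_tensor _ _ ht]
    have h1 : ε = ∑ j, W.op.posSemidef.isHermitian.eigenvalues j * ε := by
      rw [← Finset.sum_mul, W.op.sum_eigenvalues, one_mul]
    conv_rhs => rw [h1]
    rw [← Finset.sum_add_distrib]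
    refine Finset.sum_le_sum fun j _ => ?_
    have hj := W.op.posSemidef.eigenvalues_nonneg j
    rw [← mul_add]
    exact mul_le_mul_of_nonneg_left (h _ (div_nonneg ht hj)) hj

section Meter

variable {d d₁ d₂ : ℕ}

theorem stepMeter_additive (j : Fin d) (j₁ : Fin d₁) (j₂ : Fin d₂) :
    smoothAdiabatic.Equivalent ((stepMeter d).state j)
        (smoothAdiabatic.comp ((stepMeter d₁).state j₁) ((stepMeter d₂).state j₂)) ↔
      (stepMeter d).label j = (stepMeter d₁).label j₁ + (stepMeter d₂).label j₂ := by
  have hm : (0 : ℝ) < ((j : ℕ) : ℝ) + 1 := by positivity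
  have hm₁ : (0 : ℝ) < ((j₁ : ℕ) : ℝ) + 1 := by positivity
  have hm₂ : (0 : ℝ) < ((j₂ : ℕ) : ℝ) + 1 := by positivity
  have hx : ∀ t, 0 ≤ t → ((stepMeter d).state j).op.excess t =
      max (1 - (((j : ℕ) : ℝ) + 1) * t) 0 := fun t ht => excess_stepState j ht
  have hy : ∀ t, 0 ≤ t →
      (smoothAdiabatic.comp ((stepMeter d₁).state j₁) ((stepMeter d₂).state j₂)).op.excess t =
        max (1 - (((j₁ : ℕ) : ℝ) + 1) * (((j₂ : ℕ) : ℝ) + 1) * t) 0 := fun t ht => by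
    refine (excess_tensor_stepState (stepState j₁) j₂ ht).trans ?_
    rw [excess_stepState j₁ (mul_nonneg hm₂.le ht), mul_assoc]
  have hl : (stepMeter d).label j = (stepMeter d₁).label j₁ + (stepMeter d₂).label j₂ ↔
      ((j : ℕ) : ℝ) + 1 = (((j₁ : ℕ) : ℝ) + 1) * (((j₂ : ℕ) : ℝ) + 1) := by
    change Real.logb 2 _ = Real.logb 2 _ + Real.logb 2 _ ↔ _
    rw [← Real.logb_mul hm₁.ne' hm₂.ne']
    exact (Real.logb_injOn_pos (by norm_num)).eq_iff (Set.mem_Ioi.mpr hm)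
      (Set.mem_Ioi.mpr (mul_pos hm₁ hm₂))
  rw [hl, ErrorTolerantTheory.Equivalent, smoothAdiabatic_rel_zero_iff,
    smoothAdiabatic_rel_zero_iff, le_antisymm_iff, ← max_one_sub_mul_le_iff hm,
    ← max_one_sub_mul_le_iff (mul_pos hm₁ hm₂)]
  refine and_congr (forall₂_congr fun t ht => ?_) (forall₂_congr fun t ht => ?_) <;>
    rw [hx t ht, hy t ht]

theorem stepMeter_rel_zero_iff (j₁ : Fin d₁) (j₂ : Fin d₂) :
    smoothAdiabatic.rel 0 ((stepMeter d₁).state j₁) ((stepMeter d₂).state j₂) ↔ (j₁ : ℕ) ≤ j₂ := by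
  have h := max_one_sub_mul_le_iff (a := ((j₁ : ℕ) : ℝ) + 1) (b := ((j₂ : ℕ) : ℝ) + 1)
    (by positivity)
  rw [add_le_add_iff_right, Nat.cast_le] at h
  rw [← h, smoothAdiabatic_rel_zero_iff]
  refine forall₂_congr fun t ht => ?_
  change (stepState j₂).excess t ≤ (stepState j₁).excess t ↔ _
  rw [excess_stepState j₁ ht, excess_stepState j₂ ht]

theorem stepMeter_label_le_iff (j₁ : Fin d₁) (j₂ : Fin d₂) :
    (stepMeter d₁).label j₁ ≤ (stepMeter d₂).label j₂ ↔ (j₁ : ℕ) ≤ j₂ := by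
  change Real.logb 2 _ ≤ Real.logb 2 _ ↔ _
  rw [Real.logb_le_logb (by norm_num) (by positivity) (by positivity), add_le_add_iff_right,
    Nat.cast_le]

/-- With meter states of ranks `m₁` and `m₂` attached, smooth majorisation compares the excess
functions at the thresholds `m₁ t` and `m₂ t`. -/
theorem comp_stepMeter_rel_iff {n : ℕ} (ρ σ : DensityOp n) (j₁ j₂ : Fin d) {ε : ℝ}
    (hε : 0 ≤ ε) :
    smoothAdiabatic.rel ε (smoothAdiabatic.comp ⟨n, ρ⟩ ((stepMeter d).state j₁))
        (smoothAdiabatic.comp ⟨n, σ⟩ ((stepMeter d).state j₂)) ↔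
      ∀ t, 0 ≤ t → σ.excess ((((j₂ : ℕ) : ℝ) + 1) * t) ≤
        ρ.excess ((((j₁ : ℕ) : ℝ) + 1) * t) + ε := by
  rw [smoothAdiabatic_rel_iff _ _ hε]
  refine forall₂_congr fun t ht => ?_
  rw [← excess_tensor_stepState ρ j₁ ht, ← excess_tensor_stepState σ j₂ ht]
  rfl

theorem stepMeter_reduction {n : ℕ} (ρ σ : DensityOp n) (j : Fin d) {ε : ℝ} (hε : 0 ≤ ε)
    (h : smoothAdiabatic.rel ε (smoothAdiabatic.comp ⟨n, ρ⟩ ((stepMeter d).state j))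
      (smoothAdiabatic.comp ⟨n, σ⟩ ((stepMeter d).state j))) :
    smoothAdiabatic.rel ε ⟨n, ρ⟩ ⟨n, σ⟩ := by
  rw [comp_stepMeter_rel_iff ρ σ j j hε] at h
  refine (smoothAdiabatic_rel_iff _ _ hε).mpr fun t ht => ?_
  have hj : (0 : ℝ) < ((j : ℕ) : ℝ) + 1 := by positivity
  have h1 := h (t / (((j : ℕ) : ℝ) + 1)) (div_nonneg ht hj.le)
  rwa [mul_div_cancel₀ _ hj.ne'] at h1

theorem stepMeter_resource_error (j₁ : Fin d₁) (j₂ : Fin d₂) {ε : ℝ} (hε : 0 ≤ ε)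
    (h : smoothAdiabatic.rel ε ((stepMeter d₁).state j₁) ((stepMeter d₂).state j₂)) :
    (((stepMeter d₁).label j₁ : ℝ) : EReal) ≤
      (((stepMeter d₂).label j₂ : ℝ) : EReal) + ErrorTolerantTheory.tradeoff ε := by
  have hj₁ : (0 : ℝ) < ((j₁ : ℕ) : ℝ) + 1 := by positivity
  rw [ErrorTolerantTheory.tradeoff]
  split_ifs with hε1
  · rw [smoothAdiabatic_rel_iff _ _ hε] at h
    -- at the threshold `1 / (j₁ + 1)` the excess of the first meter state vanishes
    have ht : 0 ≤ (((j₁ : ℕ) : ℝ) + 1)⁻¹ := inv_nonneg.mpr hj₁.le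
    have h1 : (stepState j₂).excess _ ≤ (stepState j₁).excess _ + ε := h _ ht
    rw [excess_stepState _ ht, excess_stepState _ ht, mul_inv_cancel₀ hj₁.ne', sub_self,
      max_self, zero_add] at h1
    have h2 := (le_max_left _ _).trans h1
    have h3 : (1 - ε) * (((j₁ : ℕ) : ℝ) + 1) ≤ ((j₂ : ℕ) : ℝ) + 1 := by
      rw [← le_div_iff₀ hj₁, div_eq_mul_inv]
      linarith
    have h4 := Real.logb_le_logb_of_le (b := 2) (by norm_num)
      (mul_pos (sub_pos.mpr hε1) hj₁) h3
    rw [Real.logb_mul (sub_pos.mpr hε1).ne' hj₁.ne'] at h4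
    rw [← EReal.coe_add, EReal.coe_le_coe_iff]
    change Real.logb 2 _ ≤ Real.logb 2 _ + _
    linarith
  · rw [EReal.coe_add_top]
    exact le_top

theorem stepMeter_obeysMeterAxioms (n : ℕ) (hd : 1 < d) :
    smoothAdiabatic.ObeysMeterAxioms (stateSpace n) (stepMeter d) where
  reduction := by
    rintro _ ⟨ρ, rfl⟩ _ ⟨σ, rfl⟩ j ε hε h
    exact stepMeter_reduction ρ σ j hε h
  additive j j₁ j₂ := stepMeter_additive j j₁ j₂
  nontrivial := by
    refine ⟨(⟨0, by omega⟩ : Fin d), (⟨1, hd⟩ : Fin d), fun h => ?_⟩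
    have := (stepMeter_rel_zero_iff (⟨1, hd⟩ : Fin d) (⟨0, by omega⟩ : Fin d)).mp h.2
    simp at this
  ordering j₁ j₂ := (stepMeter_label_le_iff j₁ j₂).trans (stepMeter_rel_zero_iff j₁ j₂).symm
  resource_error j₁ j₂ _ hε _ _ h := stepMeter_resource_error j₁ j₂ hε h

theorem basisState_isReference {n : ℕ} (i₀ : Fin n) (hd : n ≤ d) :
    smoothAdiabatic.IsReference (stateSpace n) (stepMeter d) ⟨n, basisState i₀⟩ := by
  have hn : 0 < n := i₀.pos
  refine ⟨⟨basisState i₀, rfl⟩, ?_⟩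
  rintro _ ⟨ρ, rfl⟩
  refine ⟨(⟨0, by omega⟩ : Fin d), (⟨0, by omega⟩ : Fin d), (⟨0, by omega⟩ : Fin d),
    (⟨n - 1, by omega⟩ : Fin d), (comp_stepMeter_rel_iff _ _ _ _ le_rfl).mpr fun t ht => ?_,
    (comp_stepMeter_rel_iff _ _ _ _ le_rfl).mpr fun t ht => ?_⟩
  · rw [excess_basisState _ (by positivity), add_zero]
    exact ρ.excess_le (by positivity)
  · rw [excess_basisState _ (by positivity)]
    have hcast : ((n - 1 : ℕ) : ℝ) + 1 = n := by
      rw [← Nat.cast_add_one, Nat.sub_add_cancel hn]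
    simp only [hcast, Nat.cast_zero, zero_add, one_mul, add_zero]
    refine max_le ?_ (excess_nonneg _ _)
    have := sumLargest_le_excess_add ρ ht n
    rw [sumLargest_of_le ρ le_rfl] at this
    linarith

end Meter

/-! ### The entropies -/

section Entropies

variable {n d : ℕ}

/-- The ratios of ranks of two meter states of a common size are dense in the positive reals. -/
theorem exists_stepMeter_ratio_between {x y : ℝ} (hx : 0 ≤ x) (hxy : x < y) :
    ∃ d : ℕ, 1 < d ∧ ∃ j₁ j₂ : Fin d,
      x < (((j₂ : ℕ) : ℝ) + 1) / (((j₁ : ℕ) : ℝ) + 1) ∧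
        (((j₂ : ℕ) : ℝ) + 1) / (((j₁ : ℕ) : ℝ) + 1) < y := by
  obtain ⟨q, hq1, hq2⟩ := exists_rat_btwn hxy
  have hq0 : 0 < q := by exact_mod_cast hx.trans_lt hq1
  have hnum : 0 < q.num := Rat.num_pos.mpr hq0
  have hden : 0 < q.den := q.den_pos
  have hq : (q : ℝ) = (q.num.toNat : ℝ) / (q.den : ℝ) := by
    rw [Rat.cast_def]
    congr 1
    exact_mod_cast (Int.toNat_of_nonneg hnum.le).symm
  have h1 : ((q.num.toNat - 1 : ℕ) : ℝ) + 1 = q.num.toNat := by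
    rw [← Nat.cast_add_one, Nat.sub_add_cancel (by omega)]
  have h2 : ((q.den - 1 : ℕ) : ℝ) + 1 = q.den := by
    rw [← Nat.cast_add_one, Nat.sub_add_cancel (by omega)]
  refine ⟨q.num.toNat + q.den, by omega, ⟨q.den - 1, by omega⟩, ⟨q.num.toNat - 1, by omega⟩, ?_⟩
  simp only [h1, h2]
  rw [← hq]
  exact ⟨hq1, hq2⟩

theorem stepMeter_label_sub (j₁ j₂ : Fin d) :
    (stepMeter d).label j₁ - (stepMeter d).label j₂ =
      Real.logb 2 ((((j₁ : ℕ) : ℝ) + 1) / (((j₂ : ℕ) : ℝ) + 1)) :=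
  (Real.logb_div (Nat.cast_add_one_ne_zero _) (Nat.cast_add_one_ne_zero _)).symm

/-- The reference state with a step state of rank `m₁` can be turned into `ρ` with a step state of
rank `m₂` precisely if the excess of `ρ` over `m₂ / m₁` is at most `ε`. For the other thresholds the
inequality follows from convexity and monotonicity of the excess. -/
theorem rel_basisState_iff (i₀ : Fin n) (ρ : DensityOp n) (j₁ j₂ : Fin d) {ε : ℝ} (hε : 0 ≤ ε) :
    smoothAdiabatic.rel ε (smoothAdiabatic.comp ⟨n, basisState i₀⟩ ((stepMeter d).state j₁))
        (smoothAdiabatic.comp ⟨n, ρ⟩ ((stepMeter d).state j₂)) ↔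
      ρ.excess ((((j₂ : ℕ) : ℝ) + 1) / (((j₁ : ℕ) : ℝ) + 1)) ≤ ε := by
  have hj₁ : (0 : ℝ) < ((j₁ : ℕ) : ℝ) + 1 := by positivity
  rw [comp_stepMeter_rel_iff _ _ _ _ hε]
  constructor
  · intro h
    -- at this threshold the excess of the reference state with its meter state vanishes
    have h1 := h (((j₁ : ℕ) : ℝ) + 1)⁻¹ (by positivity)
    rwa [mul_inv_cancel₀ hj₁.ne', excess_basisState _ zero_le_one, sub_self, max_self, zero_add,
      ← div_eq_mul_inv] at h1
  · intro h t ht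
    rw [excess_basisState _ (by positivity)]
    set c : ℝ := (((j₁ : ℕ) : ℝ) + 1) * t with hc
    have hct : (((j₂ : ℕ) : ℝ) + 1) * t = c * ((((j₂ : ℕ) : ℝ) + 1) / (((j₁ : ℕ) : ℝ) + 1)) := by
      rw [hc]; field_simp
    rw [hct]
    have hc0 : 0 ≤ c := by positivity
    rcases le_total c 1 with hc1 | hc1
    · have h1 := excess_mul_le ρ.posSemidef hc0 hc1
        ((((j₂ : ℕ) : ℝ) + 1) / (((j₁ : ℕ) : ℝ) + 1))
      rw [ρ.re_trace] at h1
      have h2 := mul_le_mul_of_nonneg_left h hc0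
      have h3 := le_max_left (1 - c) 0
      refine h1.trans ?_
      nlinarith
    · have h1 : ρ.excess (c * ((((j₂ : ℕ) : ℝ) + 1) / (((j₁ : ℕ) : ℝ) + 1))) ≤
          ρ.excess ((((j₂ : ℕ) : ℝ) + 1) / (((j₁ : ℕ) : ℝ) + 1)) := by
        refine Finset.sum_le_sum fun i _ => max_le_max_right _ ?_
        have : (0 : ℝ) ≤ (((j₂ : ℕ) : ℝ) + 1) / (((j₁ : ℕ) : ℝ) + 1) := by positivity
        nlinarith
      linarith [le_max_right (1 - c) 0]

/-- With `x = m₂ / m₁` the ratio of the ranks, the condition says that no threshold `s` certifies by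
duality that tests of trace `x` accept `ρ` with probability less than `1 - ε`. -/
theorem rel_to_basisState_iff (i₀ : Fin n) (ρ : DensityOp n) (j₁ j₂ : Fin d) {ε : ℝ}
    (hε : 0 ≤ ε) :
    smoothAdiabatic.rel ε (smoothAdiabatic.comp ⟨n, ρ⟩ ((stepMeter d).state j₁))
        (smoothAdiabatic.comp ⟨n, basisState i₀⟩ ((stepMeter d).state j₂)) ↔
      ∀ s, 0 ≤ s →
        1 - ε ≤ ρ.excess s + s * ((((j₂ : ℕ) : ℝ) + 1) / (((j₁ : ℕ) : ℝ) + 1)) := by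
  have hj₁ : (0 : ℝ) < ((j₁ : ℕ) : ℝ) + 1 := by positivity
  rw [comp_stepMeter_rel_iff _ _ _ _ hε]
  constructor
  · intro h s hs
    have h1 := h (s / (((j₁ : ℕ) : ℝ) + 1)) (by positivity)
    rw [excess_basisState _ (by positivity), mul_div_cancel₀ _ hj₁.ne'] at h1
    have h2 := (le_max_left _ _).trans h1
    have h3 : (((j₂ : ℕ) : ℝ) + 1) * (s / (((j₁ : ℕ) : ℝ) + 1)) =
        s * ((((j₂ : ℕ) : ℝ) + 1) / (((j₁ : ℕ) : ℝ) + 1)) := by ring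
    linarith
  · intro h t ht
    rw [excess_basisState _ (by positivity)]
    have h1 := h ((((j₁ : ℕ) : ℝ) + 1) * t) (by positivity)
    have h3 : (((j₁ : ℕ) : ℝ) + 1) * t * ((((j₂ : ℕ) : ℝ) + 1) / (((j₁ : ℕ) : ℝ) + 1)) =
        (((j₂ : ℕ) : ℝ) + 1) * t := by field_simp
    rw [h3] at h1
    exact max_le (by linarith) (add_nonneg (excess_nonneg _ _) hε)

/-- Truncating the eigenvalues of `ρ` at `s` gives a subnormalised state at distance
`tr (ρ - s)₊`; by `excess_le_of_genTraceDist_le` none with `λ_max ≤ s` is closer. -/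
theorem exists_truncation [NeZero n] (ρ : DensityOp n) {s : ℝ} (hs : 0 < s) :
    ∃ τ : SubDensityOp n, genTraceDist ρ τ = ρ.excess s ∧
      0 ≤ maxEigenvalue τ ∧ maxEigenvalue τ ≤ s := by
  set hρ := ρ.posSemidef.isHermitian
  have h0 := ρ.posSemidef.eigenvalues_nonneg
  let τ : SubDensityOp n :=
    { mat := eigenbasisDiag hρ fun i => min (hρ.eigenvalues i) s
      posSemidef := posSemidef_eigenbasisDiag _ fun i => le_min (h0 i) hs.le
      trace_le_one := by
        rw [trace_eigenbasisDiag, Complex.ofReal_re, ← ρ.sum_eigenvalues]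
        exact Finset.sum_le_sum fun i _ => min_le_left _ _ }
  have hτ : ∀ i, τ.posSemidef.isHermitian.eigenvalues i ≤ s := by
    have h : ∑ i, max (τ.posSemidef.isHermitian.eigenvalues i - s) 0 = 0 := by
      rw [sum_eigenvalues_eigenbasisDiag hρ τ.posSemidef.isHermitian rfl fun x => max (x - s) 0]
      exact Finset.sum_eq_zero fun i _ => max_eq_right (by linarith [min_le_right (hρ.eigenvalues i) s])
    intro i
    have hi := (Finset.sum_eq_zero_iff_of_nonneg fun _ _ => le_max_right _ _).mp h i
      (Finset.mem_univ i)
    linarith [le_max_left (τ.posSemidef.isHermitian.eigenvalues i - s) 0]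
  refine ⟨τ, ?_, Real.iSup_nonneg τ.posSemidef.eigenvalues_nonneg, ciSup_le hτ⟩
  have hmat : ρ.mat - τ.mat =
      eigenbasisDiag hρ (hρ.eigenvalues - fun i => min (hρ.eigenvalues i) s) := by
    rw [← eigenbasisDiag_sub, eigenbasisDiag_eigenvalues]
  rw [← excess_sub_zero_eq_genTraceDist, excess,
    sum_eigenvalues_eigenbasisDiag hρ (ρ.posSemidef.isHermitian.sub τ.posSemidef.isHermitian) hmat
      fun x => max (x - 0) 0]
  refine Finset.sum_congr rfl fun i _ => ?_
  rw [Pi.sub_apply, sub_zero]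
  rcases le_total (hρ.eigenvalues i) s with h | h
  · rw [min_eq_left h, max_eq_right (by linarith), max_eq_right (by linarith)]
  · rw [min_eq_right h]

theorem excess_le_of_genTraceDist_le (ρ : DensityOp n) (τ : SubDensityOp n) {ε s : ℝ}
    (h : genTraceDist ρ τ ≤ ε) (hs : maxEigenvalue τ ≤ s) : ρ.excess s ≤ ε := by
  have h1 := excess_le_excess_add_excess_sub ρ.posSemidef.isHermitian τ.posSemidef.isHermitian s
  have h2 : excess τ.posSemidef.isHermitian s = 0 :=
    Finset.sum_eq_zero fun i _ => max_eq_right (sub_nonpos.mpr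
      ((le_ciSup (Set.finite_range _).bddAbove i).trans hs))
  rw [excess_sub_zero_eq_genTraceDist, h2, zero_add] at h1
  exact h1.trans h

theorem le_minEntropy (τ : SubDensityOp n) {s : ℝ} (h0 : 0 ≤ maxEigenvalue τ)
    (h : maxEigenvalue τ ≤ s) : ((-Real.logb 2 s : ℝ) : EReal) ≤ minEntropy τ := by
  rw [minEntropy]
  split_ifs with h1
  · exact le_top
  · rw [EReal.coe_le_coe_iff, neg_le_neg_iff]
    exact Real.logb_le_logb_of_le (by norm_num) (lt_of_le_of_ne h0 (Ne.symm h1)) h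

theorem maxEigenvalue_lt_of_lt_minEntropy (τ : SubDensityOp n) {y : ℝ}
    (h : (y : EReal) < minEntropy τ) : maxEigenvalue τ < (2 : ℝ) ^ (-y) := by
  have h0 : 0 ≤ maxEigenvalue τ := Real.iSup_nonneg τ.posSemidef.eigenvalues_nonneg
  rw [minEntropy] at h
  split_ifs at h with h1
  · rw [h1]
    positivity
  · rw [EReal.coe_lt_coe_iff] at h
    rw [← Real.logb_lt_iff_lt_rpow (by norm_num) (lt_of_le_of_ne h0 (Ne.symm h1))]
    linarith

theorem stepMeter_label_sub_le_smoothMinEntropy (i₀ : Fin n) (ρ : DensityOp n) (j₁ j₂ : Fin d)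
    {ε : ℝ} (hε : 0 ≤ ε)
    (h : smoothAdiabatic.rel ε (smoothAdiabatic.comp ⟨n, basisState i₀⟩ ((stepMeter d).state j₁))
      (smoothAdiabatic.comp ⟨n, ρ⟩ ((stepMeter d).state j₂))) :
    (((stepMeter d).label j₁ - (stepMeter d).label j₂ : ℝ) : EReal) ≤ smoothMinEntropy ε ρ := by
  have : NeZero n := ⟨i₀.pos.ne'⟩
  rw [rel_basisState_iff i₀ ρ j₁ j₂ hε] at h
  obtain ⟨τ, h1, h2, h3⟩ := exists_truncation ρ
    (s := (((j₂ : ℕ) : ℝ) + 1) / (((j₁ : ℕ) : ℝ) + 1)) (by positivity)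
  refine le_iSup₂_of_le τ (h1.trans_le h) ?_
  rw [stepMeter_label_sub, ← inv_div, Real.logb_inv]
  exact le_minEntropy τ h2 h3

theorem entropyMinus_basisState (i₀ : Fin n) (ρ : DensityOp n) {ε : ℝ} (hε : 0 ≤ ε) :
    entropyMinus (basisState i₀) ε ρ = smoothMinEntropy ε ρ := by
  apply le_antisymm
  · refine iSup₂_le fun d _ => sSup_le ?_
    rintro _ ⟨j₁, j₂, hrel, rfl⟩
    exact stepMeter_label_sub_le_smoothMinEntropy i₀ ρ j₁ j₂ hε hrel
  · refine iSup₂_le fun τ hτ => EReal.ge_of_forall_gt_iff_ge.mp fun y hy => ?_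
    obtain ⟨d, hd, j₁, j₂, h1, h2⟩ := exists_stepMeter_ratio_between
      (Real.iSup_nonneg τ.posSemidef.eigenvalues_nonneg) (maxEigenvalue_lt_of_lt_minEntropy τ hy)
    refine le_trans ?_ (le_iSup₂_of_le d hd (le_sSup ⟨j₁, j₂, (rel_basisState_iff i₀ ρ j₁ j₂ hε).mpr
      (excess_le_of_genTraceDist_le ρ τ hτ h1.le), rfl⟩))
    rw [EReal.coe_le_coe_iff, stepMeter_label_sub, ← inv_div, Real.logb_inv, le_neg]
    exact (Real.logb_lt_iff_lt_rpow (by norm_num) (by positivity)).mpr h2 |>.le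

/-- The test of trace at most `x` that collects the largest eigenvalues of `ρ`, the last one of them
with the fractional part of `x` as weight, is optimal; its dual certificate is that last
eigenvalue. -/
theorem exists_test (ρ : DensityOp n) {x : ℝ} (hx : 0 ≤ x) :
    ∃ Q : Matrix (Fin n) (Fin n) ℂ, Q.PosSemidef ∧ (1 - Q).PosSemidef ∧ Q.trace.re ≤ x ∧
      ∃ s, 0 ≤ s ∧ (Q * ρ.mat).trace.re = ρ.excess s + s * x := by
  set k := ⌊x⌋₊
  have hkx : (k : ℝ) ≤ x := Nat.floor_le hx
  have hxk : x < k + 1 := Nat.lt_floor_add_one x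
  set f : ℕ → ℝ := fun i => if i < k then 1 else if i = k then x - k else 0 with hf
  have hf0 : ∀ i, 0 ≤ f i := fun i => by
    simp only [hf]; split_ifs <;> linarith
  have hf1 : ∀ i, f i ≤ 1 := fun i => by
    simp only [hf]; split_ifs <;> linarith
  have hsum : ∀ g : ℕ → ℝ, ∀ N, k + 1 ≤ N →
      ∑ i ∈ Finset.range N, f i * g i = ∑ i ∈ Finset.range k, g i + (x - k) * g k := by
    intro g N hN
    rw [← Finset.sum_subset (Finset.range_subset_range.mpr hN), Finset.sum_range_succ]
    · congr 1
      · exact Finset.sum_congr rfl fun i hi => by simp [hf, Finset.mem_range.mp hi]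
      · simp [hf]
    · intro i _ hi
      have : k + 1 ≤ i := by simpa using hi
      simp only [hf]
      rw [if_neg (by omega), if_neg (by omega), zero_mul]
  set hρ := ρ.posSemidef.isHermitian
  refine ⟨eigenbasisDiag hρ fun i => f (eigenvaluePlace i), posSemidef_eigenbasisDiag _ fun i => hf0 _,
    posSemidef_one_sub_eigenbasisDiag _ fun i => hf1 _, ?_,
    ρ.sortedEigenvalue k, ρ.sortedEigenvalue_nonneg k, ?_⟩
  · rw [trace_eigenbasisDiag, Complex.ofReal_re, sum_eigenvaluePlace]
    have h := hsum 1 (max n (k + 1)) (le_max_right _ _)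
    simp only [Pi.one_apply, mul_one, Finset.sum_const, Finset.card_range, nsmul_eq_mul] at h
    have h2 : ∑ i ∈ Finset.range n, f i ≤ ∑ i ∈ Finset.range (max n (k + 1)), f i :=
      Finset.sum_le_sum_of_subset_of_nonneg (Finset.range_subset_range.mpr (le_max_left _ _))
        fun i _ _ => hf0 i
    linarith
  · have h := trace_eigenbasisDiag_mul_eigenbasisDiag hρ (fun i => f (eigenvaluePlace i))
      hρ.eigenvalues
    rw [eigenbasisDiag_eigenvalues] at h
    rw [h, Complex.ofReal_re]
    simp only [ρ.eigenvalues_eq_sortedEigenvalue]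
    rw [sum_eigenvaluePlace fun i => f i * ρ.sortedEigenvalue i,
      Finset.sum_subset (Finset.range_subset_range.mpr (le_max_left n (k + 1)))
        fun i _ hi => by rw [ρ.sortedEigenvalue_of_le (by simpa using hi), mul_zero],
      hsum _ _ (le_max_right _ _), ← sumLargest_eq_sum_range, ← excess_sortedEigenvalue_add]
    ring

/-- The values, optimised in the hypothesis-testing entropy, of `tr Q / α` for the tests `Q` that
accept `ρ` with probability at least `α`. -/
def testTraces (α : ℝ) (ρ : DensityOp n) : Set ℝ :=
  {x : ℝ | ∃ Q : Matrix (Fin n) (Fin n) ℂ,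
    Q.PosSemidef ∧ (1 - Q).PosSemidef ∧ α ≤ (Q * ρ.mat).trace.re ∧ x = 1 / α * Q.trace.re}

theorem one_le_of_mem_testTraces {ρ : DensityOp n} {α x : ℝ} (hα : 0 < α)
    (hx : x ∈ testTraces α ρ) : 1 ≤ x := by
  obtain ⟨Q, hQ, hQ', h, rfl⟩ := hx
  -- `ρ ≤ 1`, so `tr (Q ρ) ≤ tr Q`
  have h1 := re_trace_mul_le_excess_add ρ.posSemidef.isHermitian hQ hQ' 1
  have h2 := ρ.excess_le zero_le_one
  rw [sub_self, max_self, DensityOp.excess] at h2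
  rw [one_div, inv_mul_eq_div, one_le_div hα]
  linarith

theorem testTraces_nonempty (ρ : DensityOp n) {α : ℝ} (hα : α ≤ 1) : (testTraces α ρ).Nonempty :=
  ⟨_, 1, Matrix.PosSemidef.one, by rw [sub_self]; exact Matrix.PosSemidef.zero,
    by rwa [Matrix.one_mul, ρ.re_trace], rfl⟩

theorem sInf_testTraces_pos (ρ : DensityOp n) {α : ℝ} (hα : 0 < α) (hα' : α ≤ 1) :
    0 < sInf (testTraces α ρ) :=
  zero_lt_one.trans_le (le_csInf (testTraces_nonempty ρ hα') fun _ => one_le_of_mem_testTraces hα)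

theorem logb_le_label_sub_of_rel (i₀ : Fin n) (ρ : DensityOp n) (j₁ j₂ : Fin d) {ε : ℝ}
    (hε : 0 ≤ ε) (hε1 : ε < 1)
    (h : smoothAdiabatic.rel ε (smoothAdiabatic.comp ⟨n, ρ⟩ ((stepMeter d).state j₁))
      (smoothAdiabatic.comp ⟨n, basisState i₀⟩ ((stepMeter d).state j₂))) :
    Real.logb 2 (sInf (testTraces (1 - ε) ρ) * (1 - ε)) ≤
      (stepMeter d).label j₂ - (stepMeter d).label j₁ := by
  have hα : 0 < 1 - ε := sub_pos.mpr hε1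
  rw [rel_to_basisState_iff i₀ ρ j₁ j₂ hε] at h
  obtain ⟨Q, hQ, hQ', h1, s, hs, h2⟩ := exists_test ρ
    (x := (((j₂ : ℕ) : ℝ) + 1) / (((j₁ : ℕ) : ℝ) + 1)) (by positivity)
  rw [stepMeter_label_sub]
  refine Real.logb_le_logb_of_le (by norm_num)
    (mul_pos (sInf_testTraces_pos ρ hα (by linarith)) hα) ?_
  rw [← le_div_iff₀ hα]
  refine (csInf_le ⟨1, fun _ => one_le_of_mem_testTraces hα⟩
    ⟨Q, hQ, hQ', (h s hs).trans_eq h2.symm, rfl⟩).trans ?_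
  rw [one_div, inv_mul_eq_div]
  exact div_le_div_of_nonneg_right h1 hα.le

theorem entropyPlus_basisState (i₀ : Fin n) (ρ : DensityOp n) {ε : ℝ} (hε : 0 ≤ ε) (hε1 : ε < 1) :
    entropyPlus (basisState i₀) ε ρ =
      ((hypothesisTestingEntropy (1 - ε) ρ + Real.logb 2 (1 - ε) : ℝ) : EReal) := by
  have hα : 0 < 1 - ε := sub_pos.mpr hε1
  have hne := testTraces_nonempty ρ (show 1 - ε ≤ 1 by linarith)
  have hpos := sInf_testTraces_pos ρ hα (by linarith)
  have hH : hypothesisTestingEntropy (1 - ε) ρ + Real.logb 2 (1 - ε) =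
      Real.logb 2 (sInf (testTraces (1 - ε) ρ) * (1 - ε)) := by
    rw [Real.logb_mul hpos.ne' hα.ne']
    rfl
  rw [hH]
  apply le_antisymm
  · refine EReal.le_of_forall_lt_iff_le.mp fun y hy => ?_
    rw [EReal.coe_lt_coe_iff, Real.logb_lt_iff_lt_rpow (by norm_num) (mul_pos hpos hα)] at hy
    obtain ⟨d, hd, j₁, j₂, h1, h2⟩ := exists_stepMeter_ratio_between (mul_pos hpos hα).le hy
    rw [← lt_div_iff₀ hα] at h1
    obtain ⟨_, ⟨Q, hQ, hQ', h3, rfl⟩, h4⟩ := exists_lt_of_csInf_lt hne h1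
    rw [one_div, inv_mul_eq_div, div_lt_div_iff_of_pos_right hα] at h4
    refine iInf₂_le_of_le d hd (sInf_le_of_le ⟨j₁, j₂,
      (rel_to_basisState_iff i₀ ρ j₁ j₂ hε).mpr fun s hs => ?_, rfl⟩ ?_)
    · have h5 := re_trace_mul_le_excess_add ρ.posSemidef.isHermitian hQ hQ' s
      have h6 := mul_le_mul_of_nonneg_left h4.le hs
      rw [DensityOp.excess]
      linarith
    · rw [EReal.coe_le_coe_iff, stepMeter_label_sub]
      exact ((Real.logb_lt_iff_lt_rpow (by norm_num) (by positivity)).mpr h2).le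
  · refine le_iInf₂ fun d _ => le_sInf ?_
    rintro _ ⟨j₁, j₂, hrel, rfl⟩
    exact EReal.coe_le_coe_iff.mpr (logb_le_label_sub_of_rel i₀ ρ j₁ j₂ hε hε1 hrel)

end Entropies

end

theorem mainTheorem1 :
    -- axioms for each state space, and for all finite-dimensional states together
    ((∀ n : ℕ, smoothAdiabatic.ObeysAxioms (stateSpace n)) ∧
      smoothAdiabatic.ObeysAxioms Set.univ) ∧
    -- the step-spectrum meter
    ((∀ n d : ℕ, 1 < d →
        smoothAdiabatic.ObeysAxioms (Set.range (stepMeter d).state) ∧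
        smoothAdiabatic.ObeysMeterAxioms (stateSpace n) (stepMeter d)) ∧
      (∀ (n d : ℕ) (i₀ : Fin n), 1 < d → n ≤ d →
        smoothAdiabatic.Suitable (stateSpace n) (stepMeter d) ∧
        smoothAdiabatic.IsReference (stateSpace n) (stepMeter d) ⟨n, basisState i₀⟩) ∧
      -- additivity of meter states also holds between meters of different sizes
      (∀ (d d₁ d₂ : ℕ) (j : Fin d) (j₁ : Fin d₁) (j₂ : Fin d₂),
        smoothAdiabatic.Equivalent ((stepMeter d).state j)
            (smoothAdiabatic.comp ((stepMeter d₁).state j₁) ((stepMeter d₂).state j₂)) ↔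
          (stepMeter d).label j = (stepMeter d₁).label j₁ + (stepMeter d₂).label j₂)) ∧
    -- the entropies, with reference state |0⟩⟨0|
    (∀ (n : ℕ) (i₀ : Fin n) (ρ : DensityOp n) (ε : ℝ), 0 ≤ ε → ε ≤ 1 →
      entropyMinus (basisState i₀) ε ρ = smoothMinEntropy ε ρ) ∧
    (∀ (n : ℕ) (i₀ : Fin n) (ρ : DensityOp n) (ε : ℝ), 0 ≤ ε → ε < 1 →
      entropyPlus (basisState i₀) ε ρ =
        ((hypothesisTestingEntropy (1 - ε) ρ + Real.logb 2 (1 - ε) : ℝ) : EReal)) := by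
  refine ⟨⟨fun n => smoothAdiabatic_obeysAxioms _, smoothAdiabatic_obeysAxioms _⟩,
    ⟨fun n d hd => ⟨smoothAdiabatic_obeysAxioms _, stepMeter_obeysMeterAxioms n hd⟩,
      fun n d i₀ hd hnd => ⟨⟨smoothAdiabatic_obeysAxioms _, stepMeter_obeysMeterAxioms n hd,
        ⟨_, basisState_isReference i₀ hnd⟩⟩, basisState_isReference i₀ hnd⟩,
      fun d d₁ d₂ j j₁ j₂ => stepMeter_additive j j₁ j₂⟩,
    fun n i₀ ρ ε hε _ => entropyMinus_basisState i₀ ρ hε,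
    fun n i₀ ρ ε hε hε1 => entropyPlus_basisState i₀ ρ hε hε1⟩
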